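/- Let $1<\beta\le 2$, $\sigma\in\{1,-1\}$ and $\mathbb{T}^2=\mathbb{R}^2/\mathbb{Z}^2$. Let $\Lambda=(-\Delta)^{1/2}$ be defined through Fourier series (symbol $|\xi|$, $\xi=2\pi k$, $k\in\mathbb{Z}^2$), with $\Lambda^{\beta-2}$ for $\beta<2$ annihilating the zero mode, and let $\nabla^\perp=(-\partial_{x_2},\partial_{x_1})$. Consider the generalized SQG equation $$\partial_t\theta+u\cdot\nabla\theta=0,\qquad u=\nabla^\perp\psi,\qquad \psi=\sigma\Lambda^{\beta-2}\theta,\qquad \theta(\cdot,0)=\theta_0$$ (for $\sigma=-1$ and $\theta$ of mean zero, the last relation is $\Delta\psi=\Lambda^\beta\theta$ with $\psi$ of mean zero). For every real-valued $\theta_0\in L^2(\mathbb{T}^2)$ with $\int_{\mathbb{T}^2}\theta_0\,dx=0$ there is a global weak solution, that is, a function $\theta:[0,\infty)\to L^2(\mathbb{T}^2)$ such that for every $T>0$ one has $\theta\in L^\infty([0,T];L^2(\mathbb{T}^2))$ and, for every $\phi\in C_c^\infty([0,T)\times\mathbb{T}^2)$, $$\int_0^T\Big(\int_{\mathbb{T}^2}\theta\,\partial_t\phi\,dx+\frac{\sigma}{2}\int_{\mathbb{T}^2}\psi\,\big[\Lambda^{2-\beta}\nabla^\perp\cdot,\nabla\phi\big]\psi\,dx\Big)dt=-\int_{\mathbb{T}^2}\theta_0(x)\,\phi(x,0)\,dx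 .$$ Here $[\Lambda^{2-\beta}\nabla^\perp\cdot,\nabla\phi]\psi=\Lambda^{2-\beta}\nabla^\perp\cdot(\psi\nabla\phi)-\nabla\phi\cdot\nabla^\perp\Lambda^{2-\beta}\psi$ is taken in the sense of distributions; part of the assertion is that for almost every $t$ this commutator belongs to $L^2(\mathbb{T}^2)$ and that its integral against $\psi$ is integrable in time over $[0,T]$. The commutator term is the meaning given to $\int_{\mathbb{T}^2}\theta\,u\cdot\nabla\phi\,dx$, with which it agrees when $\theta$ is smooth. -/

import Mathlib

open MeasureTheory Set
open scoped ContDiff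

noncomputable section

namespace GSQG

/-- The two-dimensional periodic box `ℝ² / ℤ²`. -/
abbrev Torus : Type := UnitAddTorus (Fin 2)

/-- Lebesgue measure on the periodic box (of total mass one). -/
def torusMeasure : Measure Torus :=
  Measure.pi fun _ => AddCircle.haarAddCircle

/-- The space `L²(𝕋²)` of real-valued functions. -/
abbrev L2 : Type := Lp ℝ 2 torusMeasure

/-- A periodic distribution, given by the family of its Fourier coefficients. -/
abbrev FourierSeq : Type := (Fin 2 → ℤ) → ℂ

/-- The Fourier coefficients `∫ f(x) exp (-2πi k·x) dx` of a real function on the torus. -/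
def coeff (f : Torus → ℝ) : FourierSeq :=
  fun k => UnitAddTorus.mFourierCoeff (fun x => ((f x : ℝ) : ℂ)) k

/-- The modulus `|ξ|` of the frequency `ξ = 2πk`, so that `-Δ` has symbol `freqNorm k ^ 2`. -/
def freqNorm (k : Fin 2 → ℤ) : ℝ :=
  2 * Real.pi * Real.sqrt ((k 0 : ℝ) ^ 2 + (k 1 : ℝ) ^ 2)

/-- The operator `Λ ^ s = (-Δ) ^ (s / 2)`, the Fourier multiplier with symbol `|ξ| ^ s`.
For `s < 0` the zero mode is set to zero (`0 ^ s = 0`). -/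
def lambdaPow (s : ℝ) (f : FourierSeq) : FourierSeq :=
  fun k => ((freqNorm k ^ s : ℝ) : ℂ) * f k

/-- The derivative `∂_a` of a periodic distribution. -/
def seqPartial (a : Fin 2) (f : FourierSeq) : FourierSeq :=
  fun k => (2 * Real.pi * (k a : ℝ) : ℂ) * Complex.I * f k

/-- The product of a smooth function with coefficients `g` (which decay rapidly, so that the
series converges absolutely) and a periodic distribution with coefficients `f`. -/
def seqMul (g f : FourierSeq) : FourierSeq :=
  fun k => ∑' j : Fin 2 → ℤ, g j * f (k - j)

/-- The commutator `[Λ^s ∂_a, g] h = Λ^s ∂_a (g h) - g Λ^s ∂_a h`. -/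
def commutator (s : ℝ) (a : Fin 2) (g h : FourierSeq) : FourierSeq :=
  lambdaPow s (seqPartial a (seqMul g h)) - seqMul g (lambdaPow s (seqPartial a h))

/-- The classical partial derivative `∂_a f` of a function on the torus. -/
def torusPartial (a : Fin 2) (f : Torus → ℝ) : Torus → ℝ :=
  fun x => deriv (fun s : ℝ => f (x + Pi.single a (s : UnitAddCircle))) 0

/-- The commutator `[Λ^s ∇^⊥·, ∇φ] ψ` with `∇^⊥ = (-∂₂, ∂₁)`, that is
`Λ^s ∇^⊥·(ψ ∇φ) - ∇φ · ∇^⊥ Λ^s ψ = -[Λ^s ∂₂, ∂₁φ] ψ + [Λ^s ∂₁, ∂₂φ] ψ`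
(coordinates are numbered `0, 1` in the code). -/
def perpCommutator (s : ℝ) (φ ψ : Torus → ℝ) : FourierSeq :=
  commutator s 0 (coeff (torusPartial 1 φ)) (coeff ψ)
    - commutator s 1 (coeff (torusPartial 0 φ)) (coeff ψ)

/-- Test functions `φ ∈ C_c^∞([0,T) × 𝕋²)`: the lift of `φ` to `ℝ × ℝ²` is smooth, and `φ`
vanishes for times close to `T` and beyond. Nothing is required to vanish at time `0`. -/
structure IsTestFunction (T : ℝ) (φ : ℝ → Torus → ℝ) : Prop where
  smooth : ContDiff ℝ ∞
    (fun p : ℝ × (Fin 2 → ℝ) => φ p.1 (fun i => (p.2 i : UnitAddCircle)))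
  support : ∃ T' < T, ∀ t, T' ≤ t → ∀ x, φ t x = 0

/-- `ψ = σ Λ^(β-2) θ`. For `σ = -1` this is `Δψ = Λ^β θ` with `ψ` of mean zero. -/
def IsStreamFunction (σ β : ℝ) (θ ψ : L2) : Prop :=
  coeff ψ = fun k => (σ : ℂ) * lambdaPow (β - 2) (coeff θ) k

/-- `θ` is a weak solution on `[0,T]`, with initial value `θ₀`, of
`∂_t θ + u·∇θ = 0`, `u = ∇^⊥ψ`, `ψ = σ Λ^(β-2) θ`, where `σ = ± 1`.

Here `ψ t` is the stream function of `θ t`, and `C t` is the commutator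
`[Λ^(2-β) ∇^⊥·, ∇φ(t)] ψ(t)`, which has to be a function in `L²(𝕋²)`; both are determined by
their Fourier coefficients. The nonlinear term `∫ θ u·∇φ dx` is
`(σ/2) ∫ ψ [Λ^(2-β) ∇^⊥·, ∇φ] ψ dx`. -/
def IsWeakSolution (σ β T : ℝ) (θ₀ : L2) (θ : ℝ → L2) : Prop :=
  MemLp θ ⊤ (volume.restrict (Icc 0 T)) ∧
  ∃ ψ : ℝ → L2,
    (∀ᵐ t ∂(volume.restrict (Icc 0 T)), IsStreamFunction σ β (θ t) (ψ t)) ∧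
    ∀ φ : ℝ → Torus → ℝ, IsTestFunction T φ →
      ∃ C : ℝ → L2,
        (∀ᵐ t ∂(volume.restrict (Icc 0 T)),
          coeff (C t) = perpCommutator (2 - β) (φ t) (ψ t)) ∧
        IntegrableOn (fun t => ∫ x, ψ t x * C t x ∂torusMeasure) (Icc 0 T) ∧
        ∫ t in Icc 0 T,
            ((∫ x, θ t x * deriv (fun s => φ s x) t ∂torusMeasure)
              + σ / 2 * ∫ x, ψ t x * C t x ∂torusMeasure)
          = - ∫ x, θ₀ x * φ 0 x ∂torusMeasure

end GSQG

end

namespace GSQG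

open Filter Topology

/-! ### Frequencies and the symbol of the symmetrised nonlinearity -/

/-! Put `s = 2 - β`, so `0 ≤ s < 1`. On the Fourier side, symmetrising the sum over pairs of
interacting frequencies turns the equation into `x_k' = (σ/2) ∑_l m(k-l, l) x_{k-l} x_l`, with `m(j,
l) = (j^⊥ · l)(|j|^(-s) - |l|^(-s))`.

Everything rests on `|m(j, l)| ≤ |j + l|² |l|^(-s)` (`abs_triadSymbol_le`): both factors of `m` are
small when the output frequency `j + l` is small compared with `j` and `l`. For fixed `k` the symbol
is therefore bounded in `l`, and it tends to zero as `l → ∞`; for `s = 0` it vanishes identically.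
So each mode of the nonlinearity is defined on `ℓ²` and is continuous under coefficientwise
convergence of bounded sequences (`tendsto_nonlin`). No strong compactness is needed.

Galerkin truncations conserve the `ℓ²` norm (`re_sum_conj_mul_nonlin`), and each of their modes is
Lipschitz in time uniformly in the truncation. A diagonal subsequence converges mode by mode for all
times, and weak continuity passes to the limit in the integrated equation
(`exists_fourier_solution`).

The same bound treats the commutator: its kernel is `|k|^s m(k-j, -k)`, of size at most `|j|²`, with
`j` the frequency of the test function. Young's inequality then puts it in `L²` (`sqBound_commSeq`).
Fubini and a relabelling of frequencies identify its pairing with `ψ` with the weak form of the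
symmetrised nonlinearity (`tsum_streamSeq_mul_commSeq`). Integration by parts in time, mode by mode,
and Parseval finish the proof. -/

theorem freqNorm_eq_norm (k : Fin 2 → ℤ) :
    freqNorm k = ‖(⟨2 * Real.pi * k 0, 2 * Real.pi * k 1⟩ : ℂ)‖ := by
  rw [Complex.norm_eq_sqrt_sq_add_sq]
  have h : (2 * Real.pi * (k 0 : ℝ)) ^ 2 + (2 * Real.pi * (k 1 : ℝ)) ^ 2
      = (2 * Real.pi) ^ 2 * ((k 0 : ℝ) ^ 2 + (k 1 : ℝ) ^ 2) := by ring
  simp only [h]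
  rw [Real.sqrt_mul (by positivity), Real.sqrt_sq (by positivity), freqNorm]

theorem freqNorm_nonneg (k : Fin 2 → ℤ) : 0 ≤ freqNorm k := by
  unfold freqNorm; positivity

@[simp] theorem freqNorm_zero : freqNorm 0 = 0 := by simp [freqNorm]

@[simp] theorem freqNorm_neg (k : Fin 2 → ℤ) : freqNorm (-k) = freqNorm k := by simp [freqNorm]

theorem freqNorm_add_le (j l : Fin 2 → ℤ) : freqNorm (j + l) ≤ freqNorm j + freqNorm l := by
  simp only [freqNorm_eq_norm]
  refine le_trans (le_of_eq ?_) (norm_add_le _ _)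
  congr 1
  apply Complex.ext <;> simp <;> ring

theorem freqNorm_sub_le (j l : Fin 2 → ℤ) : freqNorm (j - l) ≤ freqNorm j + freqNorm l := by
  simpa [sub_eq_add_neg] using freqNorm_add_le j (-l)

theorem abs_freqNorm_sub_le (j l : Fin 2 → ℤ) :
    |freqNorm j - freqNorm l| ≤ freqNorm (j + l) := by
  have h₁ := freqNorm_sub_le (j + l) l
  have h₂ := freqNorm_sub_le (j + l) j
  simp only [add_sub_cancel_right, add_sub_cancel_left] at h₁ h₂
  exact abs_le.2 ⟨by linarith, by linarith⟩

theorem one_le_freqNorm {k : Fin 2 → ℤ} (hk : k ≠ 0) : 1 ≤ freqNorm k := by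
  have h : (1 : ℝ) ≤ (k 0 : ℝ) ^ 2 + (k 1 : ℝ) ^ 2 := by
    have : 1 ≤ (k 0) ^ 2 + (k 1) ^ 2 := by
      by_contra! h
      apply hk
      have h0 : (k 0) ^ 2 = 0 := by nlinarith [sq_nonneg (k 0), sq_nonneg (k 1)]
      have h1 : (k 1) ^ 2 = 0 := by nlinarith [sq_nonneg (k 0), sq_nonneg (k 1)]
      funext i
      fin_cases i
      · simpa using h0
      · simpa using h1
    exact_mod_cast this
  have h2 : 1 ≤ Real.sqrt ((k 0 : ℝ) ^ 2 + (k 1 : ℝ) ^ 2) := Real.one_le_sqrt.2 h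
  unfold freqNorm
  nlinarith [Real.pi_gt_three]

theorem freqNorm_pos {k : Fin 2 → ℤ} (hk : k ≠ 0) : 0 < freqNorm k :=
  one_pos.trans_le (one_le_freqNorm hk)

theorem norm_le_freqNorm (k : Fin 2 → ℤ) : ‖k‖ ≤ freqNorm k := by
  refine (pi_norm_le_iff_of_nonneg (freqNorm_nonneg k)).2 fun i => ?_
  have h1 : ‖k i‖ ≤ Real.sqrt ((k 0 : ℝ) ^ 2 + (k 1 : ℝ) ^ 2) := by
    rw [Int.norm_eq_abs]
    apply Real.abs_le_sqrt
    fin_cases i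
    · simp; positivity
    · simp; positivity
  unfold freqNorm
  nlinarith [Real.pi_gt_three, Real.sqrt_nonneg ((k 0 : ℝ) ^ 2 + (k 1 : ℝ) ^ 2)]

theorem freqNorm_le_norm (k : Fin 2 → ℤ) : freqNorm k ≤ 4 * Real.pi * ‖k‖ := by
  have h : Real.sqrt ((k 0 : ℝ) ^ 2 + (k 1 : ℝ) ^ 2) ≤ 2 * ‖k‖ := by
    have h0 : |(k 0 : ℝ)| ≤ ‖k‖ := by simpa [Int.norm_eq_abs] using norm_le_pi_norm k 0
    have h1 : |(k 1 : ℝ)| ≤ ‖k‖ := by simpa [Int.norm_eq_abs] using norm_le_pi_norm k 1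
    apply Real.sqrt_le_iff.2 ⟨by positivity, ?_⟩
    have := sq_le_sq' (by linarith [abs_nonneg (k 0 : ℝ), norm_nonneg k]) h0
    have := sq_le_sq' (by linarith [abs_nonneg (k 1 : ℝ), norm_nonneg k]) h1
    simp only [sq_abs] at *
    nlinarith [sq_nonneg ‖k‖]
  unfold freqNorm
  nlinarith [Real.pi_pos]

theorem tendsto_norm_cofinite : Tendsto (fun k : Fin 2 → ℤ => ‖k‖) cofinite atTop := by
  have := tendsto_norm_cocompact_atTop (E := Fin 2 → ℤ)
  rwa [cocompact_eq_cofinite] at this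

theorem tendsto_freqNorm_cofinite : Tendsto freqNorm cofinite atTop :=
  tendsto_atTop_mono norm_le_freqNorm tendsto_norm_cofinite

theorem freqNorm_rpow_neg_le_one {s : ℝ} (hs : 0 ≤ s) (k : Fin 2 → ℤ) :
    freqNorm k ^ (-s) ≤ 1 := by
  rcases eq_or_ne k 0 with rfl | hk
  · rw [freqNorm_zero]
    exact Real.zero_rpow_le_one _
  · exact Real.rpow_le_one_of_one_le_of_nonpos (one_le_freqNorm hk) (by linarith)

/-- Concavity: `|y ^ s - x ^ s| ≤ x ^ (s - 1) |y - x|` for `0 ≤ s ≤ 1`. -/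
theorem abs_rpow_sub_rpow_le {s x y : ℝ} (hs₀ : 0 ≤ s) (hs₁ : s ≤ 1) (hx : 0 < x) (hy : 0 < y) :
    |y ^ s - x ^ s| ≤ x ^ (s - 1) * |y - x| := by
  set r := y / x with hr
  have hr0 : 0 < r := div_pos hy hx
  have hyr : y = x * r := by rw [hr]; field_simp
  -- By homogeneity it is enough to compare with `x = 1`: `r ^ s` always lies between `1` and `r`.
  have key : |r ^ s - 1| ≤ |r - 1| := by
    rcases le_total 1 r with h | h
    · have h1 : 1 ≤ r ^ s := Real.one_le_rpow h hs₀
      have h2 : r ^ s ≤ r := by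
        simpa using Real.rpow_le_rpow_of_exponent_le h hs₁
      rw [abs_of_nonneg (by linarith), abs_of_nonneg (by linarith)]
      linarith
    · have h1 : r ^ s ≤ 1 := Real.rpow_le_one hr0.le h hs₀
      have h2 : r ≤ r ^ s := by
        simpa using Real.rpow_le_rpow_of_exponent_ge hr0 h hs₁
      rw [abs_of_nonpos (by linarith), abs_of_nonpos (by linarith)]
      linarith
  have e1 : y ^ s - x ^ s = x ^ s * (r ^ s - 1) := by
    rw [hyr, Real.mul_rpow hx.le hr0.le]; ring
  have e2 : x ^ (s - 1) * |y - x| = x ^ s * |r - 1| := by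
    rw [hyr, Real.rpow_sub_one hx.ne', show x * r - x = x * (r - 1) by ring, abs_mul,
      abs_of_pos hx]
    field_simp
  rw [e1, e2, abs_mul, abs_of_pos (Real.rpow_pos_of_pos hx s)]
  exact mul_le_mul_of_nonneg_left key (Real.rpow_pos_of_pos hx s).le

/-- The symbol `ξ^⊥ · η` at the frequencies `ξ = 2πj`, `η = 2πl`. -/
noncomputable def crossSymbol (j l : Fin 2 → ℤ) : ℝ :=
  (2 * Real.pi) ^ 2 * ((j 0 : ℝ) * l 1 - (j 1 : ℝ) * l 0)

theorem crossSymbol_swap (j l : Fin 2 → ℤ) : crossSymbol l j = -crossSymbol j l := by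
  unfold crossSymbol; ring

theorem crossSymbol_add_right (j l : Fin 2 → ℤ) : crossSymbol j (j + l) = crossSymbol j l := by
  simp only [crossSymbol, Pi.add_apply, Int.cast_add]; ring

@[simp] theorem crossSymbol_zero_left (l : Fin 2 → ℤ) : crossSymbol 0 l = 0 := by
  simp [crossSymbol]

@[simp] theorem crossSymbol_zero_right (l : Fin 2 → ℤ) : crossSymbol l 0 = 0 := by
  simp [crossSymbol]

theorem abs_crossSymbol_le (j l : Fin 2 → ℤ) :
    |crossSymbol j l| ≤ freqNorm j * freqNorm l := by
  have h : crossSymbol j l = (starRingEnd ℂ (⟨2 * Real.pi * j 0, 2 * Real.pi * j 1⟩ : ℂ)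
      * (⟨2 * Real.pi * l 0, 2 * Real.pi * l 1⟩ : ℂ)).im := by
    simp [crossSymbol]; ring
  rw [h, freqNorm_eq_norm, freqNorm_eq_norm, ← RCLike.norm_conj (⟨2 * Real.pi * j 0, _⟩ : ℂ),
    ← norm_mul]
  exact Complex.abs_im_le_norm _

/-- The symbol of the symmetrised quadratic nonlinearity of the equation. -/
noncomputable def triadSymbol (s : ℝ) (j l : Fin 2 → ℤ) : ℝ :=
  crossSymbol j l * (freqNorm j ^ (-s) - freqNorm l ^ (-s))

theorem triadSymbol_neg_neg (s : ℝ) (j l : Fin 2 → ℤ) :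
    triadSymbol s (-j) (-l) = triadSymbol s j l := by
  simp [triadSymbol, crossSymbol]

@[simp] theorem triadSymbol_zero_right (s : ℝ) (j : Fin 2 → ℤ) : triadSymbol s j 0 = 0 := by
  simp [triadSymbol]

@[simp] theorem triadSymbol_zero_left (s : ℝ) (j : Fin 2 → ℤ) : triadSymbol s 0 j = 0 := by
  simp [triadSymbol]

theorem triadSymbol_zero_exponent (j l : Fin 2 → ℤ) : triadSymbol 0 j l = 0 := by
  simp [triadSymbol]

/-- Each factor of the symbol gains one power of `|j + l|`. Since `j^⊥ · j = 0`, the cross product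
equals `j^⊥ · (j + l)`; by concavity `||l|^s - |j|^s| ≤ |j|^(s-1) |j + l|`. The remaining powers of
`|j|` cancel exactly, leaving `|l|^(-s)`. -/
theorem abs_triadSymbol_le {s : ℝ} (hs₀ : 0 ≤ s) (hs₁ : s ≤ 1) (j l : Fin 2 → ℤ) :
    |triadSymbol s j l| ≤ freqNorm (j + l) ^ 2 * freqNorm l ^ (-s) := by
  have hn : 0 ≤ freqNorm (j + l) ^ 2 * freqNorm l ^ (-s) :=
    mul_nonneg (sq_nonneg _) (Real.rpow_nonneg (freqNorm_nonneg l) _)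
  rcases eq_or_ne j 0 with rfl | hj
  · simpa using hn
  rcases eq_or_ne l 0 with rfl | hl
  · simpa using hn
  have hj' := freqNorm_pos hj
  have hl' := freqNorm_pos hl
  have h1 : |crossSymbol j l| ≤ freqNorm j * freqNorm (j + l) := by
    rw [← crossSymbol_add_right]; exact abs_crossSymbol_le _ _
  have h2 : |freqNorm l ^ s - freqNorm j ^ s| ≤ freqNorm j ^ (s - 1) * freqNorm (j + l) := by
    refine (abs_rpow_sub_rpow_le hs₀ hs₁ hj' hl').trans ?_
    gcongr
    rw [abs_sub_comm]
    exact abs_freqNorm_sub_le j l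
  have hjs := Real.rpow_pos_of_pos hj' s
  have hls := Real.rpow_pos_of_pos hl' s
  have h3 : freqNorm j ^ (-s) - freqNorm l ^ (-s)
      = (freqNorm l ^ s - freqNorm j ^ s) * (freqNorm j ^ s)⁻¹ * freqNorm l ^ (-s) := by
    rw [Real.rpow_neg hj'.le, Real.rpow_neg hl'.le]
    field_simp
  rw [triadSymbol, h3, abs_mul, abs_mul, abs_mul, abs_of_pos (inv_pos.2 hjs),
    abs_of_pos (Real.rpow_pos_of_pos hl' (-s))]
  calc |crossSymbol j l| * (|freqNorm l ^ s - freqNorm j ^ s| * (freqNorm j ^ s)⁻¹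
        * freqNorm l ^ (-s))
      ≤ (freqNorm j * freqNorm (j + l)) * ((freqNorm j ^ (s - 1) * freqNorm (j + l))
        * (freqNorm j ^ s)⁻¹ * freqNorm l ^ (-s)) := by
        have := Real.rpow_nonneg hl'.le (-s)
        have := freqNorm_nonneg (j + l)
        gcongr
    _ = freqNorm (j + l) ^ 2 * freqNorm l ^ (-s) := by
        rw [Real.rpow_sub_one hj'.ne']
        field_simp

/-- A bounded form of `abs_triadSymbol_le`. -/
theorem abs_triadSymbol_sub_le {s : ℝ} (hs₀ : 0 ≤ s) (hs₁ : s ≤ 1) (k l : Fin 2 → ℤ) :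
    |triadSymbol s (k - l) l| ≤ freqNorm k ^ 2 := by
  refine (abs_triadSymbol_le hs₀ hs₁ _ _).trans ?_
  rw [sub_add_cancel]
  exact mul_le_of_le_one_right (sq_nonneg _) (freqNorm_rpow_neg_le_one hs₀ l)

/-- This decay is what makes a quadratic expression weakly continuous: interactions of two high
frequencies contribute little to a fixed mode `k`. At `s = 0` the bound does not decay, but the
symbol is identically zero, because then `u = σ∇^⊥θ` is orthogonal to `∇θ`. -/
theorem tendsto_triadSymbol_cofinite {s : ℝ} (hs₀ : 0 ≤ s) (hs₁ : s ≤ 1) (k : Fin 2 → ℤ) :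
    Tendsto (fun l => triadSymbol s (k - l) l) cofinite (𝓝 0) := by
  rcases hs₀.eq_or_lt with rfl | hs
  · simp [triadSymbol_zero_exponent]
  · have h1 : Tendsto (fun l => freqNorm k ^ 2 * freqNorm l ^ (-s)) cofinite (𝓝 0) := by
      simpa using
        ((tendsto_rpow_neg_atTop hs).comp tendsto_freqNorm_cofinite).const_mul (freqNorm k ^ 2)
    refine squeeze_zero_norm (fun l => ?_) h1
    simpa using abs_triadSymbol_le hs.le hs₁ (k - l) l

/-! ### Square summable sequences and the quadratic nonlinearity -/

/-- The square of the `ℓ²` norm of `x` is at most `M`. -/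
def SqBound (M : ℝ) (x : FourierSeq) : Prop :=
  ∀ S : Finset (Fin 2 → ℤ), ∑ k ∈ S, ‖x k‖ ^ 2 ≤ M

/-- The coefficients of a real distribution. -/
def IsRealSeq (x : FourierSeq) : Prop := ∀ k, x (-k) = starRingEnd ℂ (x k)

theorem SqBound.nonneg {M : ℝ} {x : FourierSeq} (h : SqBound M x) : 0 ≤ M := by
  simpa using h ∅

theorem SqBound.summable {M : ℝ} {x : FourierSeq} (h : SqBound M x) :
    Summable fun k => ‖x k‖ ^ 2 :=
  summable_of_sum_le (fun _ => sq_nonneg _) h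

theorem SqBound.tsum_le {M : ℝ} {x : FourierSeq} (h : SqBound M x) :
    ∑' k, ‖x k‖ ^ 2 ≤ M :=
  h.summable.tsum_le_of_sum_le h

theorem SqBound.norm_le {M : ℝ} {x : FourierSeq} (h : SqBound M x) (k : Fin 2 → ℤ) :
    ‖x k‖ ≤ Real.sqrt M := by
  have := h {k}
  rw [Finset.sum_singleton] at this
  exact Real.le_sqrt_of_sq_le this

/-- Weak lower semicontinuity of the norm; bounding finite partial sums makes it immediate. -/
theorem SqBound.of_tendsto {M : ℝ} {ι : Type*} {L : Filter ι} [L.NeBot] {u : ι → FourierSeq}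
    {x : FourierSeq} (h : ∀ᶠ n in L, SqBound M (u n))
    (hu : ∀ k, Tendsto (fun n => u n k) L (𝓝 (x k))) :
    SqBound M x := fun S =>
  le_of_tendsto (tendsto_finsetSum S fun k _ => ((hu k).norm.pow 2)) (h.mono fun _ hn => hn S)

theorem SqBound.comp_injective {M : ℝ} {x : FourierSeq} (h : SqBound M x)
    {e : (Fin 2 → ℤ) → (Fin 2 → ℤ)} (he : Function.Injective e) :
    SqBound M (fun k => x (e k)) := fun S => by
  simpa [Finset.sum_map] using h (S.map ⟨e, he⟩)

theorem SqBound.mono_norm {M : ℝ} {x y : FourierSeq} (h : SqBound M x) (hy : ∀ k, ‖y k‖ ≤ ‖x k‖) :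
    SqBound M y := fun S =>
  (Finset.sum_le_sum fun k _ => pow_le_pow_left₀ (norm_nonneg _) (hy k) 2).trans (h S)

theorem SqBound.sum_mul_le {M : ℝ} {x y : FourierSeq} (hx : SqBound M x) (hy : SqBound M y)
    (S : Finset (Fin 2 → ℤ)) : ∑ k ∈ S, ‖x k‖ * ‖y k‖ ≤ M := by
  have h1 : ∑ k ∈ S, ‖x k‖ * ‖y k‖ ≤ ∑ k ∈ S, (‖x k‖ ^ 2 / 2 + ‖y k‖ ^ 2 / 2) :=
    Finset.sum_le_sum fun k _ => by nlinarith [sq_nonneg (‖x k‖ - ‖y k‖)]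
  rw [Finset.sum_add_distrib, ← Finset.sum_div, ← Finset.sum_div] at h1
  linarith [hx S, hy S]

theorem SqBound.summable_mul {M : ℝ} {x y : FourierSeq} (hx : SqBound M x) (hy : SqBound M y) :
    Summable fun k => ‖x k‖ * ‖y k‖ :=
  summable_of_sum_le (fun _ => mul_nonneg (norm_nonneg _) (norm_nonneg _)) (hx.sum_mul_le hy)

theorem SqBound.tsum_mul_le {M : ℝ} {x y : FourierSeq} (hx : SqBound M x) (hy : SqBound M y) :
    ∑' k, ‖x k‖ * ‖y k‖ ≤ M :=
  (hx.summable_mul hy).tsum_le_of_sum_le (hx.sum_mul_le hy)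

theorem SqBound.sub_left {M : ℝ} {x : FourierSeq} (h : SqBound M x) (k : Fin 2 → ℤ) :
    SqBound M (fun l => x (k - l)) :=
  h.comp_injective (sub_right_injective (b := k))

/-- The Fourier coefficients of `-u·∇θ`, where `θ` has coefficients `x`, in symmetrised form. -/
noncomputable def nonlin (σ s : ℝ) (x : FourierSeq) : FourierSeq := fun k =>
  (σ / 2 : ℂ) * ∑' l, (triadSymbol s (k - l) l : ℂ) * (x (k - l) * x l)

section

variable {s σ M : ℝ} {x : FourierSeq}

theorem norm_nonlin_term_le {c : ℝ} {k l : Fin 2 → ℤ} (hc : |triadSymbol s (k - l) l| ≤ c) :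
    ‖(triadSymbol s (k - l) l : ℂ) * (x (k - l) * x l)‖ ≤ c * (‖x (k - l)‖ * ‖x l‖) := by
  rw [norm_mul, norm_mul, Complex.norm_real, Real.norm_eq_abs]
  gcongr

theorem summable_nonlin (hs₀ : 0 ≤ s) (hs₁ : s ≤ 1) (hx : SqBound M x) (k : Fin 2 → ℤ) :
    Summable fun l => (triadSymbol s (k - l) l : ℂ) * (x (k - l) * x l) :=
  Summable.of_norm_bounded (((hx.sub_left k).summable_mul hx).mul_left (freqNorm k ^ 2))
    fun l => norm_nonlin_term_le (abs_triadSymbol_sub_le hs₀ hs₁ k l)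

/-- This bound depends on `x` only through `M`, so it supplies the time-Lipschitz constants of the
modes, uniform over all truncations. -/
theorem norm_nonlin_le (hs₀ : 0 ≤ s) (hs₁ : s ≤ 1) (hx : SqBound M x) (k : Fin 2 → ℤ) :
    ‖nonlin σ s x k‖ ≤ |σ| / 2 * (freqNorm k ^ 2 * M) := by
  have h2 : ‖(σ / 2 : ℂ)‖ = |σ| / 2 := by simp
  rw [nonlin, norm_mul, h2]
  gcongr
  refine (tsum_of_norm_bounded
    (((hx.sub_left k).summable_mul hx).mul_left (freqNorm k ^ 2)).hasSum
    fun l => norm_nonlin_term_le (abs_triadSymbol_sub_le hs₀ hs₁ k l)).trans ?_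
  rw [tsum_mul_left]
  have := (hx.sub_left k).tsum_mul_le hx
  gcongr

/-- The nonlinearity is weakly sequentially continuous. -/
theorem tendsto_nonlin (hs₀ : 0 ≤ s) (hs₁ : s ≤ 1) {ι : Type*} {L : Filter ι} [L.NeBot]
    {u : ι → FourierSeq} (hu : ∀ᶠ n in L, SqBound M (u n))
    (hux : ∀ k, Tendsto (fun n => u n k) L (𝓝 (x k))) (k : Fin 2 → ℤ) :
    Tendsto (fun n => nonlin σ s (u n) k) L (𝓝 (nonlin σ s x k)) := by
  have hx : SqBound M x := SqBound.of_tendsto hu hux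
  refine Tendsto.const_mul _ ?_
  rw [Metric.tendsto_nhds]
  intro ε hε
  -- `M + 1` replaces `M` so that `δ` makes sense when `M = 0`. Outside the finite set where the
  -- symbol exceeds `δ`, the sum is at most `δ M ≤ ε / 4` for every sequence of the ball; on that
  -- set, coefficientwise convergence is enough.
  have hM : 0 < M + 1 := by linarith [hx.nonneg]
  set δ := ε / (4 * (M + 1)) with hδ
  have hδ0 : 0 < δ := by positivity
  have hfin : {l | ¬ |triadSymbol s (k - l) l| ≤ δ}.Finite := by
    have := (Metric.tendsto_nhds.1 (tendsto_triadSymbol_cofinite hs₀ hs₁ k)) δ hδ0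
    refine (Filter.eventually_cofinite.1 this).subset fun l hl => ?_
    simp only [dist_zero_right, Real.norm_eq_abs, Set.mem_ofPred_eq, not_lt, not_le] at hl ⊢
    exact hl.le
  set S := hfin.toFinset with hS
  have tail : ∀ y : FourierSeq, SqBound M y →
      ‖∑' l, (triadSymbol s (k - l) l : ℂ) * (y (k - l) * y l)
        - ∑ l ∈ S, (triadSymbol s (k - l) l : ℂ) * (y (k - l) * y l)‖ ≤ ε / 4 := by
    intro y hy
    have hsum := summable_nonlin hs₀ hs₁ hy k
    rw [← hsum.sum_add_tsum_compl (s := S), add_sub_cancel_left]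
    have hmaj := (((hy.sub_left k).summable_mul hy).mul_left δ)
    refine (tsum_of_norm_bounded (hmaj.subtype ((S : Set (Fin 2 → ℤ))ᶜ)).hasSum
      fun l => ?_).trans ?_
    · refine norm_nonlin_term_le ?_
      by_contra hcon
      exact l.2 (Finset.mem_coe.2 (hfin.mem_toFinset.2 hcon))
    · refine (hmaj.tsum_subtype_le (fun l => δ * (‖y (k - l)‖ * ‖y l‖)) _
        fun l => by positivity).trans ?_
      rw [tsum_mul_left]
      have := (hy.sub_left k).tsum_mul_le hy
      calc δ * ∑' l, ‖y (k - l)‖ * ‖y l‖ ≤ δ * (M + 1) := by gcongr; linarith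
        _ = ε / 4 := by rw [hδ]; field_simp
  have hfinite : Tendsto (fun n => ∑ l ∈ S, (triadSymbol s (k - l) l : ℂ) * (u n (k - l) * u n l)) L
      (𝓝 (∑ l ∈ S, (triadSymbol s (k - l) l : ℂ) * (x (k - l) * x l))) :=
    tendsto_finsetSum _ fun l _ => ((hux _).mul (hux l)).const_mul _
  filter_upwards [hu, Metric.tendsto_nhds.1 hfinite (ε / 4) (by positivity)] with n hn hd
  have h1 := tail _ hn
  have h2 := tail _ hx
  rw [dist_eq_norm] at hd ⊢
  rw [norm_sub_rev] at h2
  calc _ = ‖(∑' l, (triadSymbol s (k - l) l : ℂ) * (u n (k - l) * u n l)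
        - ∑ l ∈ S, (triadSymbol s (k - l) l : ℂ) * (u n (k - l) * u n l))
        + (∑ l ∈ S, (triadSymbol s (k - l) l : ℂ) * (u n (k - l) * u n l)
          - ∑ l ∈ S, (triadSymbol s (k - l) l : ℂ) * (x (k - l) * x l))
        + (∑ l ∈ S, (triadSymbol s (k - l) l : ℂ) * (x (k - l) * x l)
          - ∑' l, (triadSymbol s (k - l) l : ℂ) * (x (k - l) * x l))‖ := by congr 1; ring
    _ ≤ _ := norm_add₃_le
    _ < ε := by linarith

theorem IsRealSeq.nonlin (hx : IsRealSeq x) : IsRealSeq (nonlin σ s x) := by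
  intro k
  have h : (starRingEnd ℂ) (σ / 2 : ℂ) = (σ / 2 : ℂ) := by
    rw [map_div₀, Complex.conj_ofReal, map_ofNat]
  rw [GSQG.nonlin, GSQG.nonlin, map_mul, h, Complex.conj_tsum, ← (Equiv.neg _).tsum_eq]
  congr 1
  refine tsum_congr fun l => ?_
  have e : -k - -l = -(k - l) := by abel
  simp only [Equiv.neg_apply]
  rw [e, triadSymbol_neg_neg, hx, hx]
  simp

theorem nonlin_eq_sum {S : Finset (Fin 2 → ℤ)} (hS : ∀ l, l ∉ S → x l = 0) (k : Fin 2 → ℤ) :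
    nonlin σ s x k
      = (σ / 2 : ℂ) * ∑ l ∈ S, (triadSymbol s (k - l) l : ℂ) * (x (k - l) * x l) := by
  rw [nonlin, tsum_eq_sum fun l hl => by simp [hS l hl]]

/-- The advective form of the nonlinearity. -/
theorem nonlin_eq_transport {S : Finset (Fin 2 → ℤ)} (hS : ∀ l, l ∉ S → x l = 0)
    (k : Fin 2 → ℤ) :
    nonlin σ s x k = σ * ∑ l ∈ S,
      (crossSymbol k l : ℂ) * ((freqNorm (k - l) ^ (-s) : ℝ) * x (k - l)) * x l := by
  set f : (Fin 2 → ℤ) → ℂ := fun l =>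
    (crossSymbol k l : ℂ) * ((freqNorm (k - l) ^ (-s) : ℝ) * x (k - l)) * x l with hf
  have hf0 : ∀ l, l ∉ S → f l = 0 := fun l hl => by simp [hf, hS l hl]
  have hsum : Summable f := summable_of_ne_finset_zero (s := S) hf0
  have hsum' : Summable fun l => f (k - l) :=
    (Equiv.subLeft k).summable_iff.2 hsum
  -- The two terms of the symbol are exchanged by `l ↦ k - l`, so each contributes the same sum and
  -- the factor `1 / 2` disappears.
  have hterm : ∀ l, (triadSymbol s (k - l) l : ℂ) * (x (k - l) * x l) = f l + f (k - l) := by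
    intro l
    have e1 : crossSymbol (k - l) l = crossSymbol k l := by
      simp [crossSymbol]; ring
    have e2 : crossSymbol k (k - l) = -crossSymbol k l := by
      simp [crossSymbol]; ring
    simp only [hf, triadSymbol, e1, e2, sub_sub_cancel]
    push_cast
    ring
  rw [nonlin, tsum_congr hterm, hsum.tsum_add hsum',
    show ∑' l, f (k - l) = ∑' l, f l from (Equiv.subLeft k).tsum_eq f, tsum_eq_sum hf0]
  ring

/-- Conservation of the `L²` norm by the truncated equation. -/
theorem re_sum_conj_mul_nonlin {S : Finset (Fin 2 → ℤ)} (hS : ∀ l, l ∉ S → x l = 0)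
    (hx : IsRealSeq x) :
    (∑ k ∈ S, starRingEnd ℂ (x k) * nonlin σ s x k).re = 0 := by
  set T : ℂ := ∑ k ∈ S, ∑ l ∈ S, starRingEnd ℂ (x k) *
    ((crossSymbol k l : ℂ) * ((freqNorm (k - l) ^ (-s) : ℝ) * x (k - l)) * x l) with hT
  have h1 : ∑ k ∈ S, starRingEnd ℂ (x k) * nonlin σ s x k = σ * T := by
    rw [hT, Finset.mul_sum]
    refine Finset.sum_congr rfl fun k _ => ?_
    rw [nonlin_eq_transport hS, ← Finset.mul_sum]
    ring
  -- Conjugation followed by exchanging `k` and `l` changes only the sign of the cross product. This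
  -- is the Fourier form of `∫ θ u·∇θ = 0`.
  have h2 : starRingEnd ℂ T = -T := by
    rw [hT, map_sum, ← Finset.sum_neg_distrib]
    simp_rw [map_sum, ← Finset.sum_neg_distrib]
    rw [Finset.sum_comm]
    refine Finset.sum_congr rfl fun k _ => Finset.sum_congr rfl fun l _ => ?_
    have e : k - l = -(l - k) := by abel
    rw [e, hx (l - k), freqNorm_neg, crossSymbol_swap k l]
    simp
    ring
  have h3 : T.re = 0 := by
    have := congrArg Complex.re h2
    simp at this
    linarith
  rw [h1, Complex.re_ofReal_mul, h3, mul_zero]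

end

/-! ### Galerkin approximation -/

/-- A compactly supported `C¹` vector field on a finite dimensional space has solutions on every
interval `[0,T]`. -/
theorem exists_solution_of_hasCompactSupport {E : Type*} [NormedAddCommGroup E] [NormedSpace ℝ E]
    [CompleteSpace E] {G : E → E} (hG : ContDiff ℝ 1 G) (hc : HasCompactSupport G)
    (v₀ : E) {T : ℝ} (hT : 0 < T) :
    ∃ v : ℝ → E, v 0 = v₀ ∧ ∀ t ∈ Icc 0 T, HasDerivWithinAt v (G (v t)) (Icc 0 T) t := by
  obtain ⟨K, hK⟩ := hG.lipschitzWith_of_hasCompactSupport hc one_ne_zero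
  obtain ⟨L, hL⟩ := hc.exists_bound_of_continuous hG.continuous
  have hL0 : 0 ≤ L := (norm_nonneg _).trans (hL v₀)
  -- `G` is bounded by `L` everywhere, so a solution cannot leave the ball of radius `L * T` before
  -- time `T`; one application covers the whole interval.
  have hPL : IsPicardLindelof (fun _ => G) (tmin := 0) (tmax := T) ⟨0, by simp [hT.le]⟩ v₀
      (⟨L, hL0⟩ * ⟨T, hT.le⟩) 0 ⟨L, hL0⟩ K := by
    refine IsPicardLindelof.of_time_independent (fun x _ => hL x) hK.lipschitzOnWith ?_
    simp only [sub_zero, sub_self, max_eq_left hT.le, NNReal.coe_zero]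
    exact le_rfl
  exact hPL.exists_eq_forall_mem_Icc_hasDerivWithinAt₀

section

variable {S : Finset (Fin 2 → ℤ)}

/-- Extension by zero of a finite family of coefficients. -/
noncomputable def extendSeq (v : S → ℂ) : FourierSeq := fun k => if h : k ∈ S then v ⟨k, h⟩ else 0

theorem extendSeq_of_notMem (v : S → ℂ) {k : Fin 2 → ℤ} (hk : k ∉ S) : extendSeq v k = 0 :=
  dif_neg hk

theorem extendSeq_coe (v : S → ℂ) (k : S) : extendSeq v k = v k := by
  simp [extendSeq]

/-- The coefficients of the real part of a distribution. -/
noncomputable def symmSeq (x : FourierSeq) : FourierSeq := fun k =>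
  (x k + starRingEnd ℂ (x (-k))) / 2

theorem isRealSeq_symmSeq (x : FourierSeq) : IsRealSeq (symmSeq x) := by
  intro k
  simp only [symmSeq, neg_neg, map_div₀, map_add, Complex.conj_conj, map_ofNat]
  rw [add_comm]

theorem IsRealSeq.symmSeq_eq {x : FourierSeq} (hx : IsRealSeq x) : symmSeq x = x := by
  funext k
  simp [symmSeq, hx k]

theorem symmSeq_of_notMem (hS : ∀ k ∈ S, -k ∈ S) {x : FourierSeq} (hx : ∀ k, k ∉ S → x k = 0)
    {k : Fin 2 → ℤ} (hk : k ∉ S) : symmSeq x k = 0 := by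
  have : -k ∉ S := fun h => hk (by simpa using hS _ h)
  simp [symmSeq, hx k hk, hx _ this]

theorem contDiff_extendSeq (k : Fin 2 → ℤ) : ContDiff ℝ 1 fun v : S → ℂ => extendSeq v k := by
  unfold extendSeq
  split_ifs with h
  · exact contDiff_apply ℝ ℂ (⟨k, h⟩ : S)
  · exact contDiff_const

theorem contDiff_symmSeq_extendSeq (k : Fin 2 → ℤ) :
    ContDiff ℝ 1 fun v : S → ℂ => symmSeq (extendSeq v) k := by
  unfold symmSeq
  exact ((contDiff_extendSeq k).add
    (Complex.conjCLE.contDiff.comp (contDiff_extendSeq (-k)))).div_const 2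

theorem contDiff_nonlin_symmSeq_extendSeq (hS : ∀ k ∈ S, -k ∈ S) (σ s : ℝ) (k : Fin 2 → ℤ) :
    ContDiff ℝ 1 fun v : S → ℂ => nonlin σ s (symmSeq (extendSeq v)) k := by
  have h : (fun v : S → ℂ => nonlin σ s (symmSeq (extendSeq v)) k) = fun v : S → ℂ =>
      (σ / 2 : ℂ) * ∑ l ∈ S, (triadSymbol s (k - l) l : ℂ) *
        (symmSeq (extendSeq v) (k - l) * symmSeq (extendSeq v) l) := by
    funext v
    exact nonlin_eq_sum (fun l hl => symmSeq_of_notMem hS (fun _ => extendSeq_of_notMem v) hl) k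
  rw [h]
  exact contDiff_const.mul (ContDiff.sum fun l _ => contDiff_const.mul
    ((contDiff_symmSeq_extendSeq _).mul (contDiff_symmSeq_extendSeq _)))

/-- The truncated equation has a real solution of conserved `L²` norm. -/
theorem exists_galerkin_solution (σ s : ℝ) {M : ℝ} {x₀ : FourierSeq}
    (hx₀ : SqBound M x₀) (hr : IsRealSeq x₀) (hS : ∀ k ∈ S, -k ∈ S) {T : ℝ} (hT : 0 < T) :
    ∃ x : ℝ → FourierSeq, (∀ k ∈ S, x 0 k = x₀ k) ∧
      ∀ t ∈ Icc 0 T, SqBound M (x t) ∧ IsRealSeq (x t) ∧ (∀ k, k ∉ S → x t k = 0) ∧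
        ∀ k ∈ S, HasDerivWithinAt (fun t => x t k) (nonlin σ s (x t) k) (Icc 0 T) t := by
  -- Inserting `symmSeq` makes the field take real-distribution values at every `v`, so reality of
  -- the solution can be proved rather than presupposed. The cutoff `χ` makes the field compactly
  -- supported; it equals one on the ball that the conserved norm confines the solution to.
  set F : (S → ℂ) → (S → ℂ) := fun v k => nonlin σ s (symmSeq (extendSeq v)) k with hF
  have hFc : ContDiff ℝ 1 F :=
    contDiff_pi.2 fun k => contDiff_nonlin_symmSeq_extendSeq hS σ s k
  let χ : ContDiffBump (0 : S → ℂ) :=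
    ⟨Real.sqrt M + 1, Real.sqrt M + 2, by positivity, by linarith⟩
  have hχ1 : ContDiff ℝ 1 (χ : (S → ℂ) → ℝ) := χ.contDiff
  obtain ⟨v, hv0, hv⟩ := exists_solution_of_hasCompactSupport (G := fun v => χ v • F v)
    (hχ1.smul hFc) χ.hasCompactSupport.smul_right (fun k => x₀ k) hT
  have hcomp : ∀ k ∈ S, ∀ t ∈ Icc 0 T, HasDerivWithinAt (fun t => extendSeq (v t) k)
      (χ (v t) • nonlin σ s (symmSeq (extendSeq (v t))) k) (Icc 0 T) t := by
    intro k hk t ht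
    have := hasDerivWithinAt_pi.1 (hv t ht) ⟨k, hk⟩
    simpa only [extendSeq, hk, dif_pos] using! this
  have h0 : ∀ k ∈ S, extendSeq (v 0) k = x₀ k := fun k hk => by
    rw [hv0]; simp [extendSeq, hk]
  have hreal : ∀ t ∈ Icc 0 T, IsRealSeq (extendSeq (v t)) := by
    intro t ht k
    by_cases hk : k ∈ S
    · have hk' := hS k hk
      have hder : ∀ t ∈ Icc 0 T, HasDerivWithinAt
          (fun t => extendSeq (v t) (-k) - starRingEnd ℂ (extendSeq (v t) k)) 0 (Icc 0 T) t := by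
        intro t ht
        have h1 := (hcomp (-k) hk' t ht).sub
          ((Complex.conjCLE.hasFDerivAt.comp_hasDerivWithinAt t (hcomp k hk t ht)))
        convert! h1 using 1
        have := (isRealSeq_symmSeq (extendSeq (v t))).nonlin (σ := σ) (s := s) k
        simp [this]
      have := constant_of_derivWithin_zero (fun t ht => (hder t ht).differentiableWithinAt)
        (fun t ht => (hder t (Ico_subset_Icc_self ht)).derivWithin
          (uniqueDiffOn_Icc hT t (Ico_subset_Icc_self ht))) t ht
      rw [h0 _ hk', h0 _ hk, hr k, sub_self, sub_eq_zero] at this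
      exact this
    · have hk' : -k ∉ S := fun h => hk (by simpa using hS _ h)
      rw [extendSeq_of_notMem _ hk, extendSeq_of_notMem _ hk', map_zero]
  -- The cutoff is a real scalar common to all modes, so it factors out of the energy derivative and
  -- does not spoil conservation.
  have hcons : ∀ t ∈ Icc 0 T, ∑ k ∈ S, ‖extendSeq (v t) k‖ ^ 2 = ∑ k ∈ S, ‖x₀ k‖ ^ 2 := by
    have hder : ∀ t ∈ Icc 0 T, HasDerivWithinAt
        (fun t => ∑ k ∈ S, ‖extendSeq (v t) k‖ ^ 2) 0 (Icc 0 T) t := by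
      intro t ht
      have h1 := HasDerivWithinAt.fun_sum (u := S) fun k hk => (hcomp k hk t ht).norm_sq
      convert! h1 using 1
      have h2 := re_sum_conj_mul_nonlin (σ := σ) (s := s)
        (fun l hl => extendSeq_of_notMem (v t) hl) (hreal t ht)
      have h3 : ∑ k ∈ S, 2 * inner ℝ (extendSeq (v t) k)
            (χ (v t) • nonlin σ s (symmSeq (extendSeq (v t))) k)
          = 2 * χ (v t) * (∑ k ∈ S, starRingEnd ℂ (extendSeq (v t) k)
            * nonlin σ s (extendSeq (v t)) k).re := by
        rw [(hreal t ht).symmSeq_eq, Complex.re_sum, Finset.mul_sum]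
        refine Finset.sum_congr rfl fun k _ => ?_
        rw [inner_smul_right, Complex.inner, mul_comm (nonlin _ _ _ _)]
        ring
      rw [h3, h2, mul_zero]
    intro t ht
    have := constant_of_derivWithin_zero (fun t ht => (hder t ht).differentiableWithinAt)
      (fun t ht => (hder t (Ico_subset_Icc_self ht)).derivWithin
        (uniqueDiffOn_Icc hT t (Ico_subset_Icc_self ht))) t ht
    rw [this]
    exact Finset.sum_congr rfl fun k hk => by rw [h0 k hk]
  have hbound : ∀ t ∈ Icc 0 T, SqBound M (extendSeq (v t)) := by
    intro t ht R
    calc ∑ k ∈ R, ‖extendSeq (v t) k‖ ^ 2 ≤ ∑ k ∈ R ∪ S, ‖extendSeq (v t) k‖ ^ 2 :=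
          Finset.sum_le_sum_of_subset_of_nonneg Finset.subset_union_left
            fun _ _ _ => sq_nonneg _
      _ = ∑ k ∈ S, ‖extendSeq (v t) k‖ ^ 2 := by
          symm
          refine Finset.sum_subset Finset.subset_union_right fun k _ hk => ?_
          rw [extendSeq_of_notMem _ hk]; simp
      _ ≤ M := by rw [hcons t ht]; exact hx₀ S
  refine ⟨fun t => extendSeq (v t), h0, fun t ht => ⟨hbound t ht, hreal t ht,
    fun k => extendSeq_of_notMem _, fun k hk => ?_⟩⟩
  have hχv : χ (v t) = 1 := by
    refine χ.one_of_mem_closedBall ?_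
    rw [mem_closedBall_zero_iff]
    refine (pi_norm_le_iff_of_nonneg (by positivity)).2 fun k => ?_
    rw [← extendSeq_coe (v t) k]
    exact ((hbound t ht).norm_le k).trans (by linarith)
  have := hcomp k hk t ht
  rwa [hχv, one_smul, (hreal t ht).symmSeq_eq] at this

end

/-! ### Compactness -/

theorem continuous_nonlin {σ s M : ℝ} (hs₀ : 0 ≤ s) (hs₁ : s ≤ 1) {x : ℝ → FourierSeq}
    (hx : ∀ t, SqBound M (x t)) (hc : ∀ k, Continuous fun t => x t k) (k : Fin 2 → ℤ) :
    Continuous fun t => nonlin σ s (x t) k :=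
  continuous_iff_continuousAt.2 fun t =>
    tendsto_nonlin hs₀ hs₁ (.of_forall hx) (fun k => (hc k).tendsto t) k

theorem continuous_of_norm_sub_le {L : ℝ} {f : ℝ → ℂ} (h : ∀ t t', ‖f t - f t'‖ ≤ L * |t - t'|) :
    Continuous f := by
  refine continuous_iff_continuousAt.2 fun t => ?_
  rw [ContinuousAt, tendsto_iff_norm_sub_tendsto_zero]
  refine squeeze_zero (fun _ => norm_nonneg _) (fun t' => h t' t) ?_
  have : Continuous fun t' : ℝ => L * |t' - t| := by fun_prop
  simpa using this.tendsto t

/-- The truncated equation in integral form, with solutions extended to all times. -/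
theorem exists_galerkin_solution_integral {σ s M : ℝ} (hs₀ : 0 ≤ s) (hs₁ : s ≤ 1)
    {x₀ : FourierSeq} (hx₀ : SqBound M x₀) (hr : IsRealSeq x₀) {S : Finset (Fin 2 → ℤ)}
    (hS : ∀ k ∈ S, -k ∈ S) {T : ℝ} (hT : 0 < T) :
    ∃ x : ℝ → FourierSeq, (∀ t, SqBound M (x t)) ∧ (∀ t, IsRealSeq (x t)) ∧
      (∀ k t t', ‖x t k - x t' k‖ ≤ |σ| / 2 * (freqNorm k ^ 2 * M) * |t - t'|) ∧
      ∀ k ∈ S, ∀ t ∈ Icc 0 T, x t k = x₀ k + ∫ τ in 0..t, nonlin σ s (x τ) k := by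
  obtain ⟨y, hy0, hy⟩ := exists_galerkin_solution σ s hx₀ hr hS hT
  -- Freezing the solution outside `[0,T]` keeps the bounds and Lipschitz constants and gives all
  -- approximations the common time domain `ℝ`.
  set p : ℝ → ℝ := fun t => projIcc 0 T hT.le t with hp
  have hpm : ∀ t, p t ∈ Icc 0 T := fun t => (projIcc 0 T hT.le t).2
  have hpe : ∀ t ∈ Icc 0 T, p t = t := fun t ht => by simp [hp, projIcc_of_mem hT.le ht]
  have hlip : ∀ k t t', ‖y (p t) k - y (p t') k‖
      ≤ |σ| / 2 * (freqNorm k ^ 2 * M) * |t - t'| := by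
    intro k t t'
    have hM := hx₀.nonneg
    by_cases hk : k ∈ S
    · have := (convex_Icc 0 T).norm_image_sub_le_of_norm_hasDerivWithin_le
        (fun t ht => (hy t ht).2.2.2 k hk) (fun t ht => norm_nonlin_le hs₀ hs₁ (hy t ht).1 k)
        (hpm t') (hpm t)
      refine this.trans ?_
      gcongr
      exact abs_projIcc_sub_projIcc hT.le
    · rw [(hy _ (hpm t)).2.2.1 k hk, (hy _ (hpm t')).2.2.1 k hk, sub_zero, norm_zero]
      positivity
  have hbd : ∀ t, SqBound M (y (p t)) := fun t => (hy _ (hpm t)).1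
  refine ⟨fun t => y (p t), hbd, fun t => (hy _ (hpm t)).2.1, hlip, ?_⟩
  intro k hk t ht
  have hcont := continuous_nonlin (σ := σ) hs₀ hs₁ hbd
    (fun k => continuous_of_norm_sub_le (hlip k)) k
  have hint := intervalIntegral.integral_eq_sub_of_hasDeriv_right_of_le ht.1
    (f := fun t => y (p t) k) (f' := fun τ => nonlin σ s (y (p τ)) k)
    (continuous_of_norm_sub_le (hlip k)).continuousOn (fun τ hτ => ?_)
    (hcont.intervalIntegrable 0 t)
  · rw [hint, hpe 0 ⟨le_rfl, hT.le⟩, hy0 k hk]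
    ring
  · have hτ' : τ ∈ Ico 0 T := ⟨hτ.1.le, hτ.2.trans_le ht.2⟩
    have h1 := (hy τ (Ico_subset_Icc_self hτ')).2.2.2 k hk
    have h2 : HasDerivWithinAt (fun t => y (p t) k) (nonlin σ s (y τ) k) (Icc 0 T) τ :=
      h1.congr (fun t ht => by rw [hpe t ht]) (by rw [hpe τ (Ico_subset_Icc_self hτ')])
    simp only [hpe τ (Ico_subset_Icc_self hτ')]
    exact h2.mono_of_mem_nhdsWithin
      (mem_nhdsWithin.2 ⟨Iio T, isOpen_Iio, hτ'.2, fun z hz => ⟨hτ'.1.trans hz.2.le, hz.1.le⟩⟩)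

/-- Sequences of equi-Lipschitz, bounded coefficients have pointwise convergent subsequences. -/
theorem exists_subseq_tendsto_of_lipschitz {ι : Type*} [Countable ι] {u : ℕ → ℝ → ι → ℂ} {R : ℝ}
    {L : ι → ℝ} (hR : ∀ n t k, ‖u n t k‖ ≤ R)
    (hL : ∀ n k t t', ‖u n t k - u n t' k‖ ≤ L k * |t - t'|) :
    ∃ (φ : ℕ → ℕ) (x : ℝ → ι → ℂ), StrictMono φ ∧
      ∀ t k, Tendsto (fun n => u (φ n) t k) atTop (𝓝 (x t k)) := by
  -- The product over modes and rational times is countable, so a compact set in it is sequentially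
  -- compact and one subsequence serves all of them. The Lipschitz bound then carries the Cauchy
  -- property to real times.
  have hcpt : IsCompact (Set.pi univ fun _ : ι × ℚ => Metric.closedBall (0 : ℂ) R) :=
    isCompact_univ_pi fun _ => isCompact_closedBall _ _
  obtain ⟨z, -, φ, hφ, hz⟩ := hcpt.tendsto_subseq (x := fun n p => u n (p.2 : ℝ) p.1)
    fun n p _ => by simpa using hR n p.2 p.1
  have hz' : ∀ (q : ℚ) k, Tendsto (fun n => u (φ n) q k) atTop (𝓝 (z (k, q))) := fun q k =>
    (tendsto_pi_nhds.1 hz) (k, q)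
  have hlim : ∀ t k, ∃ c, Tendsto (fun n => u (φ n) t k) atTop (𝓝 c) := by
    intro t k
    refine cauchySeq_tendsto_of_complete (Metric.cauchySeq_iff.2 fun ε hε => ?_)
    have hL0 : 0 ≤ L k := by
      have := (norm_nonneg _).trans (hL 0 k 1 0)
      simpa using this
    obtain ⟨q, hq1, hq2⟩ := exists_rat_btwn
      (show t < t + ε / (4 * (L k + 1)) by linarith [show 0 < ε / (4 * (L k + 1)) by positivity])
    have hd : L k * |t - q| ≤ ε / 4 := by
      rw [abs_sub_comm, abs_of_pos (by linarith)]
      calc L k * (q - t) ≤ (L k + 1) * (ε / (4 * (L k + 1))) := by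
            gcongr <;> linarith
        _ = ε / 4 := by field_simp
    obtain ⟨N, hN⟩ := Metric.cauchySeq_iff.1 (hz' q k).cauchySeq (ε / 4) (by positivity)
    refine ⟨N, fun m hm n hn => ?_⟩
    have h1 := hL (φ m) k t q
    have h2 := hL (φ n) k q t
    have h3 := hN m hm n hn
    rw [abs_sub_comm] at h2
    rw [dist_eq_norm] at h3 ⊢
    calc _ = ‖(u (φ m) t k - u (φ m) q k) + (u (φ m) q k - u (φ n) q k)
          + (u (φ n) q k - u (φ n) t k)‖ := by congr 1; ring
      _ ≤ _ := norm_add₃_le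
      _ < ε := by linarith
  choose x hx using hlim
  exact ⟨φ, x, hφ, hx⟩

theorem eventually_mem_Icc_natCast (k : Fin 2 → ℤ) :
    ∀ᶠ n : ℕ in atTop, k ∈ Finset.Icc (fun _ => -(n : ℤ)) (fun _ : Fin 2 => (n : ℤ)) := by
  filter_upwards [eventually_ge_atTop (∑ i, (k i).natAbs)] with n hn
  rw [Finset.mem_Icc, Pi.le_def, Pi.le_def, ← forall_and]
  intro i
  have := Finset.single_le_sum (f := fun i => (k i).natAbs) (fun _ _ => Nat.zero_le _)
    (Finset.mem_univ i)
  omega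

/-- Global solutions of the equation for the Fourier coefficients. -/
theorem exists_fourier_solution {σ s M : ℝ} (hs₀ : 0 ≤ s) (hs₁ : s ≤ 1)
    {x₀ : FourierSeq} (hx₀ : SqBound M x₀) (hr : IsRealSeq x₀) :
    ∃ x : ℝ → FourierSeq, (∀ t, SqBound M (x t)) ∧ (∀ t, IsRealSeq (x t)) ∧
      (∀ k, Continuous fun t => x t k) ∧
      ∀ k t, 0 ≤ t → x t k = x₀ k + ∫ τ in 0..t, nonlin σ s (x τ) k := by
  -- The frequency box `[-n, n]²` and the time interval `[0, n + 1]` grow together, so any fixed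
  -- mode and time are eventually covered. The box is symmetric, as reality requires, and `n + 1`
  -- keeps the interval nontrivial at `n = 0`.
  have hex := fun n : ℕ => exists_galerkin_solution_integral (σ := σ) hs₀ hs₁ hx₀ hr
    (S := Finset.Icc (fun _ => -(n : ℤ)) (fun _ : Fin 2 => (n : ℤ)))
    (fun k hk => by
      rw [Finset.mem_Icc, Pi.le_def, Pi.le_def] at hk ⊢
      exact ⟨fun i => by simpa using hk.2 i, fun i => by simpa using neg_le_neg (hk.1 i)⟩)
    (T := n + 1) (by positivity)
  choose u hu hur huL hui using hex
  obtain ⟨φ, x, hφ, hx⟩ := exists_subseq_tendsto_of_lipschitz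
    (fun n t k => (hu n t).norm_le k) huL
  have hb : ∀ t, SqBound M (x t) := fun t =>
    SqBound.of_tendsto (.of_forall fun n => hu (φ n) t) (hx t)
  refine ⟨x, hb, fun t k => ?_, fun k => ?_, fun k t ht => ?_⟩
  · refine tendsto_nhds_unique (hx t (-k)) ?_
    refine ((Complex.continuous_conj.tendsto _).comp (hx t k)).congr fun n => ?_
    exact (hur (φ n) t k).symm
  · exact continuous_of_norm_sub_le fun t t' =>
      le_of_tendsto ((hx t k).sub (hx t' k)).norm (.of_forall fun n => huL (φ n) k t t')
  · have h1 : Tendsto (fun n => ∫ τ in 0..t, nonlin σ s (u (φ n) τ) k) atTop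
        (𝓝 (∫ τ in 0..t, nonlin σ s (x τ) k)) := by
      refine intervalIntegral.tendsto_integral_filter_of_dominated_convergence
        (fun _ => |σ| / 2 * (freqNorm k ^ 2 * M)) ?_ ?_ ?_ ?_
      · refine .of_forall fun n => (continuous_nonlin hs₀ hs₁ (hu (φ n))
          (fun k => continuous_of_norm_sub_le (huL (φ n) k)) k).aestronglyMeasurable
      · exact .of_forall fun n => .of_forall fun τ _ => norm_nonlin_le hs₀ hs₁ (hu (φ n) τ) k
      · exact intervalIntegrable_const
      · exact .of_forall fun τ _ => tendsto_nonlin hs₀ hs₁ (.of_forall fun n => hu (φ n) τ) (hx τ) k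
    refine tendsto_nhds_unique (hx t k) ((h1.const_add (x₀ k)).congr' ?_)
    have h2 : ∀ᶠ n : ℕ in atTop, t ≤ n + 1 := by
      filter_upwards [eventually_ge_atTop ⌈t⌉₊] with n hn
      have := Nat.ceil_le.1 hn
      linarith
    filter_upwards [hφ.tendsto_atTop.eventually h2,
      hφ.tendsto_atTop.eventually (eventually_mem_Icc_natCast k)] with n hn hk
    exact (hui (φ n) k hk t ⟨ht, hn⟩).symm

/-! ### Fourier series of square integrable functions -/

instance isProbabilityMeasure_torusMeasure : IsProbabilityMeasure torusMeasure := by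
  unfold torusMeasure; infer_instance

instance isAddHaarMeasure_torusMeasure : torusMeasure.IsAddHaarMeasure := by
  unfold torusMeasure; infer_instance

/-- The Hilbert basis of trigonometric monomials. -/
noncomputable def fourierBasis : HilbertBasis (Fin 2 → ℤ) ℂ (Lp ℂ 2 torusMeasure) :=
  UnitAddTorus.mFourierBasis

theorem fourierBasis_repr (f : Lp ℂ 2 torusMeasure) (k : Fin 2 → ℤ) :
    fourierBasis.repr f k = UnitAddTorus.mFourierCoeff f k :=
  UnitAddTorus.mFourierBasis_repr f k

theorem mFourierCoeff_eq_integral_torus (f : Torus → ℂ) (k : Fin 2 → ℤ) :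
    UnitAddTorus.mFourierCoeff f k = ∫ x, UnitAddTorus.mFourier (-k) x * f x ∂torusMeasure :=
  rfl

theorem coeff_eq_integral (f : Torus → ℝ) (k : Fin 2 → ℤ) :
    coeff f k = ∫ x, UnitAddTorus.mFourier (-k) x * (f x : ℂ) ∂torusMeasure :=
  rfl

theorem coeff_congr_ae {f g : Torus → ℝ} (h : f =ᵐ[torusMeasure] g) : coeff f = coeff g := by
  funext k
  rw [coeff_eq_integral, coeff_eq_integral]
  exact integral_congr_ae (h.mono fun x hx => by simp only [hx])

theorem isRealSeq_coeff (f : Torus → ℝ) : IsRealSeq (coeff f) := by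
  intro k
  rw [coeff_eq_integral, coeff_eq_integral, ← integral_conj]
  congr 1
  funext x
  rw [UnitAddTorus.mFourier_neg (n := -k)]
  simp

/-- The inclusion of the real `L²` space into the complex one. -/
noncomputable def complexify : L2 →L[ℝ] Lp ℂ 2 torusMeasure :=
  Complex.ofRealCLM.compLpL 2 torusMeasure

/-- The real part of a complex `L²` function. -/
noncomputable def realPart : Lp ℂ 2 torusMeasure →L[ℝ] L2 :=
  Complex.reCLM.compLpL 2 torusMeasure

theorem coeFn_complexify (f : L2) : complexify f =ᵐ[torusMeasure] fun x => ((f x : ℝ) : ℂ) :=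
  Complex.ofRealCLM.coeFn_compLpL f

theorem coeFn_realPart (f : Lp ℂ 2 torusMeasure) :
    realPart f =ᵐ[torusMeasure] fun x => (f x).re :=
  Complex.reCLM.coeFn_compLpL f

theorem norm_complexify_le (f : L2) : ‖complexify f‖ ≤ ‖f‖ := by
  have := Complex.ofRealCLM.norm_compLp_le (μ := torusMeasure) (p := 2) f
  rwa [Complex.ofRealCLM_norm, one_mul] at this

theorem norm_realPart_le (f : Lp ℂ 2 torusMeasure) : ‖realPart f‖ ≤ ‖f‖ := by
  have := Complex.reCLM.norm_compLp_le (μ := torusMeasure) (p := 2) f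
  rwa [Complex.reCLM_norm, one_mul] at this

theorem realPart_complexify (f : L2) : realPart (complexify f) = f := by
  apply Lp.ext
  filter_upwards [coeFn_realPart (complexify f), coeFn_complexify f] with x h1 h2
  rw [h1, h2, Complex.ofReal_re]

theorem coeff_eq_repr (f : L2) (k : Fin 2 → ℤ) :
    coeff f k = fourierBasis.repr (complexify f) k := by
  rw [fourierBasis_repr, mFourierCoeff_eq_integral_torus, coeff_eq_integral]
  refine integral_congr_ae ?_
  filter_upwards [coeFn_complexify f] with x hx
  rw [hx]

theorem sqBound_repr (g : Lp ℂ 2 torusMeasure) :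
    SqBound (‖g‖ ^ 2) (fun k => fourierBasis.repr g k) := by
  intro S
  have h := lp.sum_rpow_le_norm_rpow (p := 2) (by norm_num) (fourierBasis.repr g) S
  simpa using h

theorem sqBound_coeff (f : L2) : SqBound (‖f‖ ^ 2) (coeff f) := by
  intro S
  simp only [coeff_eq_repr]
  exact (sqBound_repr (complexify f) S).trans
    (pow_le_pow_left₀ (norm_nonneg _) (norm_complexify_le f) 2)

/-- Riesz–Fischer for real functions. -/
theorem exists_coeff_eq {x : FourierSeq} {M : ℝ} (hx : SqBound M x) (hr : IsRealSeq x) :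
    ∃ f : L2, coeff f = x ∧ ‖f‖ ≤ Real.sqrt M := by
  have hmem : Memℓp x 2 := memℓp_gen (by simpa using hx.summable)
  set y : lp (fun _ : Fin 2 → ℤ => ℂ) 2 := ⟨x, hmem⟩ with hy
  set g := fourierBasis.repr.symm y with hg
  have hgn : ‖g‖ ≤ Real.sqrt M := by
    rw [hg, LinearIsometryEquiv.norm_map]
    refine Real.le_sqrt_of_sq_le ?_
    have h := lp.norm_rpow_eq_tsum (p := 2) (by norm_num) y
    simp only [ENNReal.toReal_ofNat, Real.rpow_ofNat] at h
    rw [h]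
    exact hx.tsum_le
  have hgc : ∀ k, UnitAddTorus.mFourierCoeff g k = x k := fun k => by
    rw [← fourierBasis_repr, hg, LinearIsometryEquiv.apply_symm_apply]
  refine ⟨realPart g, ?_, (norm_realPart_le g).trans hgn⟩
  funext k
  have hint : ∀ k, Integrable
      (fun t => UnitAddTorus.mFourier (-k) t * g t) torusMeasure := fun k =>
    ((Lp.memLp g).integrable one_le_two).bdd_mul (c := 1)
      (ContinuousMap.continuous _).aestronglyMeasurable
      (.of_forall fun t => (ContinuousMap.norm_coe_le_norm _ t).trans UnitAddTorus.mFourier_norm.le)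
  -- Taking real parts averages the coefficient at `k` with the conjugate of that at `-k`; the two
  -- agree because `x` is a real sequence.
  have h1 : coeff (realPart g) k = ∫ t, (UnitAddTorus.mFourier (-k) t * g t
      + starRingEnd ℂ (UnitAddTorus.mFourier (- -k) t * g t)) / 2 ∂torusMeasure := by
    rw [coeff_eq_integral]
    refine integral_congr_ae ?_
    filter_upwards [coeFn_realPart g] with t ht
    rw [ht, UnitAddTorus.mFourier_neg (n := -k), Complex.re_eq_add_conj]
    simp only [map_mul, Complex.conj_conj]
    ring
  rw [h1, integral_div, integral_add (hint k), integral_conj]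
  · rw [← mFourierCoeff_eq_integral_torus, ← mFourierCoeff_eq_integral_torus, hgc, hgc, hr]
    simp
  · exact (Complex.conjCLE.toContinuousLinearMap.integrable_comp (hint (-k)))

/-- Parseval's identity for real functions. -/
theorem hasSum_coeff_mul_coeff (f g : L2) :
    HasSum (fun k => coeff f (-k) * coeff g k)
      ((∫ x, f x * g x ∂torusMeasure : ℝ) : ℂ) := by
  have h := UnitAddTorus.hasSum_prod_mFourierCoeff (complexify f) (complexify g)
  have e : (∫ t, starRingEnd ℂ (complexify f t) * complexify g t ∂torusMeasure)
      = ((∫ x, f x * g x ∂torusMeasure : ℝ) : ℂ) := by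
    refine (integral_congr_ae ?_).trans integral_ofReal
    filter_upwards [coeFn_complexify f, coeFn_complexify g] with x h1 h2
    rw [h1, h2]
    simp
  rw [← e]
  convert! h using 2 with k
  rw [isRealSeq_coeff, coeff_eq_repr, coeff_eq_repr, fourierBasis_repr, fourierBasis_repr]
  rfl

/-- An `L²`-valued function with continuous Fourier coefficients is strongly measurable. -/
theorem stronglyMeasurable_of_continuous_coeff {θ : ℝ → L2}
    (h : ∀ k, Continuous fun t => coeff (θ t) k) : StronglyMeasurable θ := by
  have hlim : ∀ t, Tendsto (fun S : Finset (Fin 2 → ℤ) =>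
      realPart (∑ k ∈ S, coeff (θ t) k • fourierBasis k)) atTop (𝓝 (θ t)) := by
    intro t
    have h1 : HasSum (fun k => coeff (θ t) k • fourierBasis k) (complexify (θ t)) := by
      simpa only [coeff_eq_repr] using fourierBasis.hasSum_repr (complexify (θ t))
    have h2 := (realPart.continuous.tendsto _).comp h1
    rwa [realPart_complexify] at h2
  refine stronglyMeasurable_of_tendsto atTop (fun S => ?_) (tendsto_pi_nhds.2 hlim)
  refine Continuous.stronglyMeasurable (realPart.continuous.comp ?_)
  exact continuous_finsetSum _ fun k _ => (h k).smul continuous_const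

/-! ### Smooth functions on the torus -/

/-- The projection of `ℝ²` onto the torus. -/
def torusMk (y : Fin 2 → ℝ) : Torus := fun i => (y i : UnitAddCircle)

/-- Joint smoothness of a time dependent function on the torus. -/
def SmoothLift (φ : ℝ → Torus → ℝ) : Prop :=
  ContDiff ℝ ∞ fun p : ℝ × (Fin 2 → ℝ) => φ p.1 (torusMk p.2)

theorem torusMk_add_single (y : Fin 2 → ℝ) (a : Fin 2) (s : ℝ) :
    torusMk (y + Pi.single a s) = torusMk y + Pi.single a (s : UnitAddCircle) := by
  funext i
  rcases eq_or_ne i a with rfl | h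
  · simp [torusMk]
  · simp [torusMk, h]

theorem exists_torusMk_eq (x : Torus) : ∃ y ∈ Icc (0 : Fin 2 → ℝ) 1, torusMk y = x := by
  refine ⟨fun i => AddCircle.equivIco 1 0 (x i), ⟨fun i => ?_, fun i => ?_⟩, ?_⟩
  · exact (AddCircle.equivIco 1 0 (x i)).2.1
  · have := (AddCircle.equivIco 1 0 (x i)).2.2.le
    simpa using this
  · funext i
    exact AddCircle.coe_equivIco

theorem isOpenQuotientMap_torusMk : IsOpenQuotientMap torusMk :=
  IsOpenQuotientMap.piMap fun _ => QuotientAddGroup.isOpenQuotientMap_mk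

section

variable {φ : ℝ → Torus → ℝ}

/-- Smoothness is only given on the cover; continuity descends because the projection is an open
quotient map, and remains one after taking the product with time. -/
theorem SmoothLift.continuous_uncurry (hφ : SmoothLift φ) :
    Continuous fun p : ℝ × Torus => φ p.1 p.2 := by
  have h : IsOpenQuotientMap (Prod.map id torusMk : ℝ × (Fin 2 → ℝ) → ℝ × Torus) :=
    IsOpenQuotientMap.id.prodMap isOpenQuotientMap_torusMk
  exact h.isQuotientMap.continuous_iff.2 hφ.continuous

theorem SmoothLift.continuous (hφ : SmoothLift φ) (t : ℝ) : Continuous (φ t) :=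
  hφ.continuous_uncurry.comp (by fun_prop : Continuous fun x : Torus => (t, x))

theorem SmoothLift.exists_bound (hφ : SmoothLift φ) (a b : ℝ) :
    ∃ C, ∀ t ∈ Icc a b, ∀ x, |φ t x| ≤ C := by
  obtain ⟨C, hC⟩ := (isCompact_Icc (a := a) (b := b)).prod (isCompact_univ (X := Torus))
    |>.exists_bound_of_continuousOn hφ.continuous_uncurry.continuousOn
  exact ⟨C, fun t ht x => hC (t, x) ⟨ht, mem_univ _⟩⟩

theorem SmoothLift.hasDerivAt (hφ : SmoothLift φ) (t : ℝ) (x : Torus) :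
    HasDerivAt (fun s => φ s x) (deriv (fun s => φ s x) t) t := by
  obtain ⟨y, -, rfl⟩ := exists_torusMk_eq x
  have h : ContDiff ℝ ∞ fun s : ℝ => φ s (torusMk y) :=
    ContDiff.comp (g := fun p : ℝ × (Fin 2 → ℝ) => φ p.1 (torusMk p.2)) hφ
      (by fun_prop : ContDiff ℝ ∞ fun s : ℝ => (s, y))
  exact (h.differentiable (by simp) t).hasDerivAt

theorem SmoothLift.timeDeriv (hφ : SmoothLift φ) :
    SmoothLift fun t x => deriv (fun s => φ s x) t := by
  have h : (fun p : ℝ × (Fin 2 → ℝ) => deriv (fun s => φ s (torusMk p.2)) p.1)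
      = fun p => fderiv ℝ (fun p : ℝ × (Fin 2 → ℝ) => φ p.1 (torusMk p.2)) p (1, 0) := by
    funext p
    have h1 := (ContDiff.differentiable hφ (by simp) p).hasFDerivAt
    have h2 : HasDerivAt (fun s : ℝ => (s, p.2)) (1, 0) p.1 :=
      (hasDerivAt_id p.1).prodMk (hasDerivAt_const _ _)
    exact (h1.comp_hasDerivAt (f := fun s : ℝ => (s, p.2)) p.1 h2).deriv
  unfold SmoothLift
  rw [h]
  exact (ContDiff.fderiv_right hφ (by simp)).clm_apply contDiff_const

theorem SmoothLift.torusPartial (hφ : SmoothLift φ) (a : Fin 2) :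
    SmoothLift fun t => torusPartial a (φ t) := by
  have h : (fun p : ℝ × (Fin 2 → ℝ) => GSQG.torusPartial a (φ p.1) (torusMk p.2))
      = fun p => fderiv ℝ (fun p : ℝ × (Fin 2 → ℝ) => φ p.1 (torusMk p.2)) p
        (0, Pi.single a 1) := by
    funext p
    have h1 := (ContDiff.differentiable hφ (by simp) p).hasFDerivAt
    have h2 : HasDerivAt (fun s : ℝ => (p.1, p.2 + s • Pi.single a (1 : ℝ)))
        (0, Pi.single a 1) 0 := by
      refine (hasDerivAt_const _ _).prodMk ?_
      simpa using ((hasDerivAt_id (0 : ℝ)).smul_const (Pi.single a (1 : ℝ))).const_add p.2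
    have h3 := (HasFDerivAt.comp_hasDerivAt (f := fun s : ℝ => (p.1, p.2 + s • Pi.single a (1 : ℝ)))
      (0 : ℝ) (by simpa using h1) h2).deriv
    rw [← h3, GSQG.torusPartial]
    congr 1
    funext s
    simp only [Function.comp]
    rw [← torusMk_add_single, ← Pi.single_smul, smul_eq_mul, mul_one]
  unfold SmoothLift
  rw [h]
  exact (ContDiff.fderiv_right hφ (by simp)).clm_apply contDiff_const

theorem SmoothLift.translate (hφ : SmoothLift φ) (t : ℝ) (a : Fin 2) :
    SmoothLift fun s x => φ t (x + Pi.single a (s : UnitAddCircle)) := by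
  have h : (fun p : ℝ × (Fin 2 → ℝ) => φ t (torusMk p.2 + Pi.single a (p.1 : UnitAddCircle)))
      = fun p => φ t (torusMk (p.2 + p.1 • Pi.single a (1 : ℝ))) := by
    funext p
    rw [← torusMk_add_single, ← Pi.single_smul, smul_eq_mul, mul_one]
  unfold SmoothLift
  rw [h]
  exact ContDiff.comp (g := fun p : ℝ × (Fin 2 → ℝ) => φ p.1 (torusMk p.2)) hφ
    (by fun_prop : ContDiff ℝ ∞ fun p : ℝ × (Fin 2 → ℝ) => (t, p.2 + p.1 • Pi.single a (1 : ℝ)))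

/-! ### Fourier coefficients of smooth functions: derivatives, translations and decay. -/

theorem norm_mFourier_apply_le (k : Fin 2 → ℤ) (x : Torus) : ‖UnitAddTorus.mFourier k x‖ ≤ 1 :=
  (ContinuousMap.norm_coe_le_norm _ x).trans UnitAddTorus.mFourier_norm.le

theorem norm_coeff_le {C : ℝ} {f : Torus → ℝ} (hf : ∀ x, |f x| ≤ C)
    (k : Fin 2 → ℤ) : ‖coeff f k‖ ≤ C := by
  rw [coeff_eq_integral]
  have := norm_integral_le_of_norm_le_const (μ := torusMeasure) (C := C)
    (f := fun x => UnitAddTorus.mFourier (-k) x * (f x : ℂ)) (.of_forall fun x => ?_)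
  · simpa using this
  · rw [norm_mul, Complex.norm_real, Real.norm_eq_abs]
    have h1 := norm_mFourier_apply_le (-k) x
    have h2 := hf x
    have h3 := abs_nonneg (f x)
    nlinarith

theorem SmoothLift.hasDerivAt_coeff (hφ : SmoothLift φ) (k : Fin 2 → ℤ) (t : ℝ) :
    HasDerivAt (fun t => coeff (φ t) k) (coeff (fun x => deriv (fun s => φ s x) t) k) t := by
  obtain ⟨C, hC⟩ := hφ.timeDeriv.exists_bound (t - 1) (t + 1)
  have hc : ∀ f : Torus → ℝ, Continuous f →
      Continuous fun x => UnitAddTorus.mFourier (-k) x * (f x : ℂ) := fun f hf =>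
    (ContinuousMap.continuous _).mul (Complex.continuous_ofReal.comp hf)
  refine (hasDerivAt_integral_of_dominated_loc_of_deriv_le (𝕜 := ℝ) (μ := torusMeasure)
    (F := fun s x => UnitAddTorus.mFourier (-k) x * (φ s x : ℂ))
    (F' := fun s x => UnitAddTorus.mFourier (-k) x * ((deriv (fun s => φ s x) s : ℝ) : ℂ))
    (bound := fun _ => C) (s := Icc (t - 1) (t + 1)) (Icc_mem_nhds (by linarith) (by linarith))
    (.of_forall fun s => (hc _ (hφ.continuous s)).aestronglyMeasurable)
    ((hc _ (hφ.continuous t)).integrable_of_hasCompactSupport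
      (HasCompactSupport.of_compactSpace _))
    (hc _ (hφ.timeDeriv.continuous t)).aestronglyMeasurable
    (.of_forall fun x s hs => ?_) (integrable_const C) (.of_forall fun x s hs => ?_)).2
  · rw [norm_mul, Complex.norm_real, Real.norm_eq_abs]
    have h1 := norm_mFourier_apply_le (-k) x
    have h2 := hC s hs x
    have h3 := abs_nonneg (deriv (fun s => φ s x) s)
    nlinarith
  · exact ((hφ.hasDerivAt s x).ofReal_comp).const_mul _

theorem mFourier_apply_add (k : Fin 2 → ℤ) (x y : Torus) :
    UnitAddTorus.mFourier k (x + y) = UnitAddTorus.mFourier k x * UnitAddTorus.mFourier k y := by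
  simp only [UnitAddTorus.mFourier, ContinuousMap.coe_mk, Pi.add_apply, fourier_apply, smul_add,
    AddCircle.toCircle_add, Circle.coe_mul, Finset.prod_mul_distrib]

theorem mFourier_apply_single (k : Fin 2 → ℤ) (a : Fin 2) (s : ℝ) :
    UnitAddTorus.mFourier k (Pi.single a (s : UnitAddCircle))
      = Complex.exp (2 * Real.pi * k a * Complex.I * s) := by
  have h : ∀ i, fourier (k i) ((Pi.single a (s : UnitAddCircle) : Torus) i)
      = if i = a then Complex.exp (2 * Real.pi * k a * Complex.I * s) else 1 := by
    intro i
    split_ifs with hi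
    · subst hi
      rw [Pi.single_eq_same, fourier_coe_apply]
      congr 1
      push_cast
      ring
    · rw [Pi.single_eq_of_ne hi, fourier_eval_zero]
  simp only [UnitAddTorus.mFourier, ContinuousMap.coe_mk, h]
  simp

theorem coeff_translate (f : Torus → ℝ) (k : Fin 2 → ℤ) (a : Fin 2) (s : ℝ) :
    coeff (fun x => f (x + Pi.single a (s : UnitAddCircle))) k
      = Complex.exp (2 * Real.pi * k a * Complex.I * s) * coeff f k := by
  rw [coeff_eq_integral, coeff_eq_integral, ← integral_const_mul,
    ← integral_add_right_eq_self
      (fun x => Complex.exp (2 * Real.pi * k a * Complex.I * s)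
        * (UnitAddTorus.mFourier (-k) x * (f x : ℂ))) (Pi.single a (s : UnitAddCircle))]
  congr 1
  funext x
  rw [mFourier_apply_add, mFourier_apply_single]
  have : Complex.exp (2 * Real.pi * k a * Complex.I * s)
      * Complex.exp (2 * Real.pi * ((-k) a : ℤ) * Complex.I * s) = 1 := by
    rw [← Complex.exp_add]
    simp
  linear_combination (-UnitAddTorus.mFourier (-k) x
    * (f (x + Pi.single a (s : UnitAddCircle)) : ℂ)) * this

/-- Translation by `s` in direction `a` multiplies the `k`-th coefficient by `exp(2πi k_a s)`. The
translate is itself a `SmoothLift` with `s` as time, so differentiating under the integral at `s =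
0` gives the claim without integration by parts in space. -/
theorem SmoothLift.coeff_torusPartial (hφ : SmoothLift φ) (t : ℝ) (a : Fin 2) :
    coeff (GSQG.torusPartial a (φ t)) = seqPartial a (coeff (φ t)) := by
  funext k
  have h1 := (hφ.translate t a).hasDerivAt_coeff k 0
  simp only [coeff_translate] at h1
  have h2 : HasDerivAt (fun s : ℝ => Complex.exp (2 * Real.pi * k a * Complex.I * s)
      * coeff (φ t) k) (2 * Real.pi * k a * Complex.I * coeff (φ t) k) 0 := by
    have h3 : HasDerivAt (fun s : ℝ => 2 * Real.pi * k a * Complex.I * (s : ℂ))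
        (2 * Real.pi * k a * Complex.I) 0 := by
      simpa using ((hasDerivAt_id (0 : ℝ)).ofReal_comp).const_mul
        (2 * Real.pi * k a * Complex.I : ℂ)
    simpa using h3.cexp.mul_const (coeff (φ t) k)
  have := h1.unique h2
  rw [seqPartial]
  push_cast
  exact this

theorem SmoothLift.exists_decay (hφ : SmoothLift φ) (a b : ℝ) (n : ℕ) :
    ∃ C, ∀ t ∈ Icc a b, ∀ k, ‖k‖ ^ n * ‖coeff (φ t) k‖ ≤ C := by
  induction n generalizing φ with
  | zero =>
    obtain ⟨C, hC⟩ := hφ.exists_bound a b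
    exact ⟨C, fun t ht k => by simpa using norm_coeff_le (hC t ht) k⟩
  | succ n ih =>
    obtain ⟨C₀, h₀⟩ := ih (hφ.torusPartial 0)
    obtain ⟨C₁, h₁⟩ := ih (hφ.torusPartial 1)
    refine ⟨max C₀ C₁, fun t ht k => ?_⟩
    have key : ∀ i : Fin 2, ‖k‖ ^ n * (‖k i‖ * ‖coeff (φ t) k‖) ≤ max C₀ C₁ := by
      intro i
      have h : ‖k i‖ * ‖coeff (φ t) k‖ ≤ ‖coeff (GSQG.torusPartial i (φ t)) k‖ := by
        rw [hφ.coeff_torusPartial, seqPartial, norm_mul]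
        gcongr
        simp only [norm_mul, Complex.norm_I, mul_one, Complex.norm_ofNat, Complex.norm_real,
          Real.norm_eq_abs, abs_of_pos Real.pi_pos, Int.norm_eq_abs]
        have := abs_nonneg (k i : ℝ)
        nlinarith [Real.pi_gt_three]
      refine (mul_le_mul_of_nonneg_left h (by positivity)).trans ?_
      fin_cases i
      · exact (h₀ t ht k).trans (le_max_left _ _)
      · exact (h₁ t ht k).trans (le_max_right _ _)
    obtain ⟨i, hi⟩ : ∃ i, ‖k‖ = ‖k i‖ := by
      obtain ⟨i, -, hi⟩ := Finset.exists_mem_eq_sup' (Finset.univ_nonempty) (fun i => ‖k i‖₊)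
      refine ⟨i, ?_⟩
      rw [Pi.norm_def, ← coe_nnnorm, ← hi, Finset.sup'_eq_sup]
    have := key i
    rw [← hi] at this
    calc _ = ‖k‖ ^ n * (‖k‖ * ‖coeff (φ t) k‖) := by ring
      _ ≤ _ := this

/-- The coefficients of a smooth function decay rapidly, uniformly in bounded time intervals. -/
theorem SmoothLift.exists_summable_bound (hφ : SmoothLift φ) (a b : ℝ) :
    ∃ w : (Fin 2 → ℤ) → ℝ, (∀ k, 0 ≤ w k) ∧ (Summable fun k => (1 + freqNorm k ^ 2) * w k) ∧
      ∀ t ∈ Icc a b, ∀ k, ‖coeff (φ t) k‖ ≤ w k := by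
  -- Decay of order five leaves `‖k‖^(-3)` after the weight `1 + |k|²`, which is summable over `ℤ²`.
  -- Order zero is needed only for the mode `k = 0`.
  obtain ⟨C₀, h₀⟩ := hφ.exists_decay a b 0
  obtain ⟨C₅, h₅⟩ := hφ.exists_decay a b 5
  have hs : Summable fun k : Fin 2 → ℤ => ‖k‖ ^ (-3 : ℝ) :=
    EisensteinSeries.summable_one_div_norm_rpow (by norm_num)
  refine ⟨fun k => if k = 0 then |C₀| else |C₅| * (‖k‖ ^ 5)⁻¹, fun k => ?_, ?_, fun t ht k => ?_⟩
  · dsimp only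
    split_ifs <;> positivity
  · have h1 : Summable fun k : Fin 2 → ℤ =>
        (Pi.single 0 |C₀| : (Fin 2 → ℤ) → ℝ) k
          + |C₅| * (1 + (4 * Real.pi) ^ 2) * ‖k‖ ^ (-3 : ℝ) :=
      (hasSum_pi_single 0 |C₀|).summable.add (hs.mul_left _)
    refine h1.of_nonneg_of_le (fun k => ?_) fun k => ?_
    · dsimp only
      split_ifs <;> positivity
    · dsimp only
      split_ifs with hk
      · subst hk
        simp
      · rw [Pi.single_eq_of_ne hk, zero_add]
        have hk1 : 1 ≤ ‖k‖ := by
          have : 1 ≤ ‖k‖₊ := by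
            obtain ⟨i, hi⟩ := Function.ne_iff.1 hk
            refine le_trans ?_ (nnnorm_le_pi_nnnorm k i)
            rw [← NNReal.coe_le_coe, coe_nnnorm, Int.norm_eq_abs]
            have := Int.one_le_abs hi
            simpa using (by exact_mod_cast this : (1 : ℝ) ≤ |(k i : ℝ)|)
          exact_mod_cast this
        have hk0 : 0 < ‖k‖ := by linarith
        have hf := freqNorm_le_norm k
        have hf2 : freqNorm k ^ 2 ≤ (4 * Real.pi * ‖k‖) ^ 2 :=
          pow_le_pow_left₀ (freqNorm_nonneg k) hf 2
        have hle : 1 + freqNorm k ^ 2 ≤ (1 + (4 * Real.pi) ^ 2) * ‖k‖ ^ 2 := by nlinarith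
        calc (1 + freqNorm k ^ 2) * (|C₅| * (‖k‖ ^ 5)⁻¹)
            ≤ ((1 + (4 * Real.pi) ^ 2) * ‖k‖ ^ 2) * (|C₅| * (‖k‖ ^ 5)⁻¹) := by gcongr
          _ = |C₅| * (1 + (4 * Real.pi) ^ 2) * ‖k‖ ^ (-3 : ℝ) := by
              rw [Real.rpow_neg hk0.le, show (3 : ℝ) = ((3 : ℕ) : ℝ) by norm_num,
                Real.rpow_natCast]
              field_simp
  · dsimp only
    split_ifs with hk
    · have := h₀ t ht k
      rw [pow_zero, one_mul] at this
      exact this.trans (le_abs_self _)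
    · have hk0 : 0 < ‖k‖ ^ 5 := pow_pos (norm_pos_iff.2 hk) 5
      rw [← div_eq_mul_inv, le_div_iff₀ hk0, mul_comm]
      exact (h₅ t ht k).trans (le_abs_self _)

end

/-! ### The commutator -/

/-- Young's inequality `ℓ¹ * ℓ² ⊆ ℓ²`. -/
theorem SqBound.convolution {M : ℝ} {x y : FourierSeq} (hx : SqBound M x)
    {a : (Fin 2 → ℤ) → ℝ} (ha₀ : ∀ j, 0 ≤ a j) (ha : Summable a)
    (hy : ∀ k, ‖y k‖ ≤ ∑' j, a j * ‖x (k - j)‖) : SqBound ((∑' j, a j) ^ 2 * M) y := by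
  intro S
  -- The convolution is a sum over `j` of translates of `|x|` weighted by `a j`; the triangle
  -- inequality for this vector-valued sum, restricted to `S`, is the whole proof.
  set v : (Fin 2 → ℤ) → EuclideanSpace ℝ S := fun j =>
    WithLp.toLp 2 fun k : S => a j * ‖x (k - j)‖ with hv
  have hvn : ∀ j, ‖v j‖ ≤ a j * Real.sqrt M := by
    intro j
    rw [EuclideanSpace.norm_eq]
    refine Real.sqrt_le_iff.2 ⟨mul_nonneg (ha₀ j) (Real.sqrt_nonneg _), ?_⟩
    rw [mul_pow, Real.sq_sqrt hx.nonneg]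
    have h1 := hx.comp_injective (sub_left_injective (b := j)) S
    rw [← Finset.sum_coe_sort] at h1
    calc ∑ k : S, ‖v j k‖ ^ 2 = a j ^ 2 * ∑ k : S, ‖x (k - j)‖ ^ 2 := by
          rw [Finset.mul_sum]
          refine Finset.sum_congr rfl fun k _ => ?_
          simp [hv, mul_pow]
      _ ≤ a j ^ 2 * M := by gcongr
  have hmaj : Summable fun j => a j * Real.sqrt M := ha.mul_right _
  have hsum : Summable v := .of_norm_bounded hmaj hvn
  have hnorm : ‖∑' j, v j‖ ≤ (∑' j, a j) * Real.sqrt M := by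
    refine (tsum_of_norm_bounded hmaj.hasSum hvn).trans_eq tsum_mul_right
  have hcoord : ∀ k : S, (∑' j, v j) k = ∑' j, a j * ‖x (k - j)‖ := fun k =>
    (EuclideanSpace.proj (𝕜 := ℝ) k).map_tsum hsum
  calc ∑ k ∈ S, ‖y k‖ ^ 2 = ∑ k : S, ‖y k‖ ^ 2 := (Finset.sum_coe_sort S _).symm
    _ ≤ ∑ k : S, ‖(∑' j, v j) k‖ ^ 2 := by
        refine Finset.sum_le_sum fun k _ => pow_le_pow_left₀ (norm_nonneg _) ?_ 2
        rw [hcoord]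
        exact (hy k).trans (le_abs_self _)
    _ = ‖∑' j, v j‖ ^ 2 := (EuclideanSpace.norm_sq_eq _).symm
    _ ≤ ((∑' j, a j) * Real.sqrt M) ^ 2 := pow_le_pow_left₀ (norm_nonneg _) hnorm 2
    _ = _ := by rw [mul_pow, Real.sq_sqrt hx.nonneg]

/-- The coefficients of the stream function. -/
noncomputable def streamSeq (σ s : ℝ) (x : FourierSeq) : FourierSeq := fun k =>
  (σ : ℂ) * lambdaPow (-s) x k

/-- The commutator expressed through the coefficients `x` of `θ`. -/
noncomputable def commSeq (σ s : ℝ) (g x : FourierSeq) : FourierSeq := fun k =>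
  (σ * freqNorm k ^ s : ℝ) * ∑' j, (triadSymbol s (k - j) (-k) : ℂ) * (g j * x (k - j))

section

variable {σ s M : ℝ} {x g : FourierSeq} {w : (Fin 2 → ℤ) → ℝ}

theorem norm_streamSeq_le (hσ : |σ| = 1) (hs₀ : 0 ≤ s) (k : Fin 2 → ℤ) :
    ‖streamSeq σ s x k‖ ≤ ‖x k‖ := by
  have h0 := Real.rpow_nonneg (freqNorm_nonneg k) (-s)
  rw [streamSeq, lambdaPow, norm_mul, norm_mul, Complex.norm_real, Complex.norm_real,
    Real.norm_eq_abs, Real.norm_eq_abs, hσ, one_mul, abs_of_nonneg h0]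
  exact mul_le_of_le_one_left (norm_nonneg _) (freqNorm_rpow_neg_le_one hs₀ k)

theorem IsRealSeq.streamSeq (hx : IsRealSeq x) : IsRealSeq (streamSeq σ s x) := by
  intro k
  simp [GSQG.streamSeq, lambdaPow, hx k]

theorem norm_seqPartial_le (a : Fin 2) (g : FourierSeq) (k : Fin 2 → ℤ) :
    ‖seqPartial a g k‖ ≤ freqNorm k * ‖g k‖ := by
  rw [seqPartial, norm_mul]
  gcongr
  have h : |(k a : ℝ)| ≤ Real.sqrt ((k 0 : ℝ) ^ 2 + (k 1 : ℝ) ^ 2) := by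
    apply Real.abs_le_sqrt
    fin_cases a
    · simp; positivity
    · simp; positivity
  simp only [norm_mul, Complex.norm_I, mul_one, Complex.norm_ofNat, Complex.norm_real,
    Real.norm_eq_abs, abs_of_pos Real.pi_pos]
  unfold freqNorm
  gcongr

/-- `Λ^s` undoes the smoothing in `ψ = σΛ^(-s)θ`, so `Λ^s∇ψ` costs only one derivative of `θ`. This
makes the product series in the commutator absolutely convergent. -/
theorem norm_lambdaPow_streamSeq_le (hσ : |σ| = 1) (k : Fin 2 → ℤ) :
    freqNorm k ^ s * (freqNorm k * ‖streamSeq σ s x k‖) ≤ freqNorm k * ‖x k‖ := by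
  rcases eq_or_ne k 0 with rfl | hk
  · simp
  have hk' := freqNorm_pos hk
  have h0 := Real.rpow_nonneg hk'.le (-s)
  rw [streamSeq, lambdaPow, norm_mul, norm_mul, Complex.norm_real, Complex.norm_real,
    Real.norm_eq_abs, Real.norm_eq_abs, hσ, one_mul, abs_of_nonneg h0, Real.rpow_neg hk'.le]
  have := (Real.rpow_pos_of_pos hk' s).ne'
  refine le_of_eq ?_
  field_simp

/-- The commutator of a stream function with the derivatives of a smooth function. -/
theorem commutator_sub_commutator_eq (hσ : |σ| = 1) (hs₀ : 0 ≤ s)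
    (hx : SqBound M x) (hg : ∀ k, ‖g k‖ ≤ w k)
    (hw : Summable fun k => (1 + freqNorm k ^ 2) * w k) :
    commutator s 0 (seqPartial 1 g) (streamSeq σ s x)
      - commutator s 1 (seqPartial 0 g) (streamSeq σ s x) = commSeq σ s g x := by
  funext k
  set h := streamSeq σ s x with hh
  have hR := hx.norm_le
  have hw0 : ∀ j, 0 ≤ w j := fun j => (norm_nonneg _).trans (hg j)
  have hn1 : ∀ j, freqNorm j ≤ 1 + freqNorm j ^ 2 := fun j => by
    nlinarith [sq_nonneg (freqNorm j - 1), freqNorm_nonneg j]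
  have hA : ∀ b, Summable fun j => seqPartial b g j * h (k - j) := by
    intro b
    refine .of_norm_bounded (hw.mul_right (Real.sqrt M)) fun j => ?_
    rw [norm_mul]
    have h1 := norm_seqPartial_le b g j
    have h2 := (norm_streamSeq_le (x := x) hσ hs₀ (k - j)).trans (hR _)
    have h3 := hg j
    have h4 := freqNorm_nonneg j
    have h5 := hn1 j
    have h6 := hw0 j
    calc ‖seqPartial b g j‖ * ‖h (k - j)‖ ≤ (freqNorm j * ‖g j‖) * Real.sqrt M := by gcongr
      _ ≤ ((1 + freqNorm j ^ 2) * w j) * Real.sqrt M := by gcongr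
  have hB : ∀ a b, Summable fun j => seqPartial b g j * lambdaPow s (seqPartial a h) (k - j) := by
    intro a b
    refine .of_norm_bounded (hw.mul_right ((freqNorm k + 1) * Real.sqrt M)) fun j => ?_
    rw [norm_mul]
    have h1 := norm_seqPartial_le b g j
    have h2 : ‖lambdaPow s (seqPartial a h) (k - j)‖ ≤ freqNorm (k - j) * Real.sqrt M := by
      have h0 := Real.rpow_nonneg (freqNorm_nonneg (k - j)) s
      rw [lambdaPow, norm_mul, Complex.norm_real, Real.norm_eq_abs, abs_of_nonneg h0]
      calc _ ≤ freqNorm (k - j) ^ s * (freqNorm (k - j) * ‖h (k - j)‖) := by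
            gcongr; exact norm_seqPartial_le _ _ _
        _ ≤ freqNorm (k - j) * ‖x (k - j)‖ := norm_lambdaPow_streamSeq_le hσ _
        _ ≤ _ := by
            have := freqNorm_nonneg (k - j)
            gcongr
            exact hR _
    have h3 := hg j
    have h4 := freqNorm_nonneg j
    have h5 := freqNorm_nonneg k
    have h6 := hw0 j
    have h7 := freqNorm_sub_le k j
    have h8 : freqNorm j * freqNorm (k - j) ≤ (1 + freqNorm j ^ 2) * (freqNorm k + 1) := by
      nlinarith [hn1 j, mul_le_mul_of_nonneg_left h7 h4, mul_le_mul_of_nonneg_right (hn1 j) h5]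
    calc ‖seqPartial b g j‖ * ‖lambdaPow s (seqPartial a h) (k - j)‖
        ≤ (freqNorm j * ‖g j‖) * (freqNorm (k - j) * Real.sqrt M) := by gcongr
      _ = (freqNorm j * freqNorm (k - j)) * (‖g j‖ * Real.sqrt M) := by ring
      _ ≤ ((1 + freqNorm j ^ 2) * (freqNorm k + 1)) * (w j * Real.sqrt M) := by gcongr
      _ = _ := by ring
  -- Both products in the commutator converge absolutely on their own, so they may be subtracted
  -- termwise; the cancellation that lowers the order then takes place inside a single series.
  have hcomm : ∀ a b, HasSum (fun j => (freqNorm k ^ s : ℝ)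
        * ((2 * Real.pi * (k a : ℝ) : ℂ) * Complex.I * (seqPartial b g j * h (k - j)))
        - seqPartial b g j * lambdaPow s (seqPartial a h) (k - j))
      (commutator s a (seqPartial b g) h k) := by
    intro a b
    exact (((hA b).hasSum.mul_left _).mul_left _).sub (hB a b).hasSum
  rw [Pi.sub_apply, commSeq, ← tsum_mul_left]
  refine HasSum.unique ((hcomm 0 1).sub (hcomm 1 0)) ?_
  have hkey : (fun j => (freqNorm k ^ s : ℝ)
        * ((2 * Real.pi * (k 0 : ℝ) : ℂ) * Complex.I * (seqPartial 1 g j * h (k - j)))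
        - seqPartial 1 g j * lambdaPow s (seqPartial 0 h) (k - j)
        - ((freqNorm k ^ s : ℝ)
        * ((2 * Real.pi * (k 1 : ℝ) : ℂ) * Complex.I * (seqPartial 0 g j * h (k - j)))
        - seqPartial 0 g j * lambdaPow s (seqPartial 1 h) (k - j)))
      = fun j => ((σ * freqNorm k ^ s : ℝ) : ℂ)
        * ((triadSymbol s (k - j) (-k) : ℂ) * (g j * x (k - j))) := by
    funext j
    have e1 : (freqNorm k ^ s : ℝ)
        * ((2 * Real.pi * (k 0 : ℝ) : ℂ) * Complex.I * (seqPartial 1 g j * h (k - j)))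
        - seqPartial 1 g j * lambdaPow s (seqPartial 0 h) (k - j)
        - ((freqNorm k ^ s : ℝ)
        * ((2 * Real.pi * (k 1 : ℝ) : ℂ) * Complex.I * (seqPartial 0 g j * h (k - j)))
        - seqPartial 0 g j * lambdaPow s (seqPartial 1 h) (k - j))
        = ((-(crossSymbol k j * (freqNorm k ^ s - freqNorm (k - j) ^ s)
          * freqNorm (k - j) ^ (-s)) : ℝ) : ℂ) * (σ * (g j * x (k - j))) := by
      simp only [seqPartial, lambdaPow, hh, streamSeq, crossSymbol, Pi.sub_apply]
      push_cast
      linear_combination (4 * Real.pi ^ 2 * (k 0 * j 1 - k 1 * j 0 : ℂ)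
        * ((freqNorm k ^ s : ℝ) - (freqNorm (k - j) ^ s : ℝ) : ℂ)
        * (freqNorm (k - j) ^ (-s) : ℝ) * σ * g j * x (k - j)) * Complex.I_sq
    have e2 : -(crossSymbol k j * (freqNorm k ^ s - freqNorm (k - j) ^ s)
          * freqNorm (k - j) ^ (-s)) = freqNorm k ^ s * triadSymbol s (k - j) (-k) := by
      have e3 : crossSymbol (k - j) (-k) = -crossSymbol k j := by
        simp [crossSymbol]; ring
      rw [triadSymbol, e3, freqNorm_neg]
      rcases eq_or_ne k 0 with rfl | hk
      · simp
      rcases eq_or_ne (k - j) 0 with hp | hp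
      · rw [sub_eq_zero] at hp
        subst hp
        have : crossSymbol k k = 0 := by unfold crossSymbol; ring
        simp [this]
      have hk' := freqNorm_pos hk
      have hp' := freqNorm_pos hp
      have hks := (Real.rpow_pos_of_pos hk' s).ne'
      have hps := (Real.rpow_pos_of_pos hp' s).ne'
      rw [Real.rpow_neg hk'.le, Real.rpow_neg hp'.le]
      field_simp
    rw [e1, e2]
    push_cast
    ring
  rw [← hkey]
  exact ((hcomm 0 1).sub (hcomm 1 0)).summable.hasSum

theorem abs_triadSymbol_sub_neg_le (hs₀ : 0 ≤ s) (hs₁ : s ≤ 1) (k j : Fin 2 → ℤ) :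
    |triadSymbol s (k - j) (-k)| ≤ freqNorm j ^ 2 * freqNorm k ^ (-s) := by
  have := abs_triadSymbol_le hs₀ hs₁ (k - j) (-k)
  rwa [show k - j + -k = -j by abel, freqNorm_neg, freqNorm_neg] at this

theorem IsRealSeq.commSeq (hx : IsRealSeq x) (hg : IsRealSeq g) :
    IsRealSeq (commSeq σ s g x) := by
  intro k
  rw [GSQG.commSeq, GSQG.commSeq, map_mul, Complex.conj_ofReal, freqNorm_neg, Complex.conj_tsum,
    ← (Equiv.neg _).tsum_eq]
  congr 1
  refine tsum_congr fun j => ?_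
  have e : -k - -j = -(k - j) := by abel
  simp only [Equiv.neg_apply]
  rw [e, triadSymbol_neg_neg, hx, hg]
  simp

/-- The outer `|k|^s` is absorbed by the factor `|k|^(-s)` in the symbol bound. What remains is a
convolution of `|j|² w j`, which is summable, with `θ` in `ℓ²`: all derivatives fall on the test
function. -/
theorem sqBound_commSeq (hσ : |σ| = 1) (hs₀ : 0 ≤ s) (hs₁ : s ≤ 1)
    (hx : SqBound M x) (hg : ∀ k, ‖g k‖ ≤ w k)
    (hw : Summable fun k => freqNorm k ^ 2 * w k) :
    SqBound ((∑' j, freqNorm j ^ 2 * w j) ^ 2 * M) (commSeq σ s g x) := by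
  have hw0 : ∀ j, 0 ≤ w j := fun j => (norm_nonneg _).trans (hg j)
  refine hx.convolution (fun j => mul_nonneg (sq_nonneg _) (hw0 j)) hw fun k => ?_
  have hmaj : Summable fun j => freqNorm j ^ 2 * w j * ‖x (k - j)‖ :=
    (hw.mul_right (Real.sqrt M)).of_nonneg_of_le
      (fun j => by have := hw0 j; positivity)
      fun j => mul_le_mul_of_nonneg_left (hx.norm_le _) (mul_nonneg (sq_nonneg _) (hw0 j))
  rw [commSeq, ← tsum_mul_left]
  refine tsum_of_norm_bounded hmaj.hasSum fun j => ?_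
  have h0 := Real.rpow_nonneg (freqNorm_nonneg k) s
  have h1 : freqNorm k ^ s * |triadSymbol s (k - j) (-k)| ≤ freqNorm j ^ 2 := by
    refine (mul_le_mul_of_nonneg_left (abs_triadSymbol_sub_neg_le hs₀ hs₁ k j) h0).trans ?_
    rcases eq_or_ne k 0 with rfl | hk
    · have h2 : freqNorm 0 ^ s * freqNorm 0 ^ (-s) ≤ 1 := by
        rw [freqNorm_zero]
        exact mul_le_one₀ (Real.zero_rpow_le_one _) (Real.rpow_nonneg le_rfl _)
          (Real.zero_rpow_le_one _)
      nlinarith [sq_nonneg (freqNorm j)]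
    · rw [Real.rpow_neg (freqNorm_nonneg k)]
      have := (Real.rpow_pos_of_pos (freqNorm_pos hk) s).ne'
      refine le_of_eq ?_
      field_simp
  rw [norm_mul, norm_mul, norm_mul, Complex.norm_real, Complex.norm_real, Real.norm_eq_abs,
    Real.norm_eq_abs, abs_mul, hσ, one_mul, abs_of_nonneg h0]
  calc _ = (freqNorm k ^ s * |triadSymbol s (k - j) (-k)|) * (‖g j‖ * ‖x (k - j)‖) := by ring
    _ ≤ freqNorm j ^ 2 * (w j * ‖x (k - j)‖) := by
        gcongr
        exact hg j
    _ = _ := by ring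

/-- The commutator form of the nonlinear term agrees with the weak form of `nonlin`. -/
theorem tsum_streamSeq_mul_commSeq (hσ : |σ| = 1) (hs₀ : 0 ≤ s) (hs₁ : s ≤ 1)
    (hx : SqBound M x) (hg : ∀ k, ‖g k‖ ≤ w k)
    (hw : Summable fun k => freqNorm k ^ 2 * w k) :
    (σ / 2 : ℂ) * ∑' k, streamSeq σ s x (-k) * commSeq σ s g x k
      = ∑' j, nonlin σ s x j * g (-j) := by
  have hσ2 : (σ : ℂ) * σ = 1 := by
    rw [← Complex.ofReal_mul, ← abs_mul_abs_self, hσ]; simp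
  have hw0 : ∀ j, 0 ≤ w j := fun j => (norm_nonneg _).trans (hg j)
  set f : (Fin 2 → ℤ) → (Fin 2 → ℤ) → ℂ := fun k j =>
    (triadSymbol s (k - j) (-k) : ℂ) * (g j * (x (k - j) * x (-k))) with hf
  -- The weights `|k|^(-s)` of `ψ` and `|k|^s` of the commutator cancel, and `σ² = 1`; at `k = 0`
  -- both sides vanish. Afterwards `j ↦ -j` and `k ↦ -l` turn the double sum into the nonlinearity
  -- tested against `g`.
  have h1 : ∀ k, streamSeq σ s x (-k) * commSeq σ s g x k = ∑' j, f k j := by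
    intro k
    rcases eq_or_ne k 0 with rfl | hk
    · simp [commSeq, hf]
    have hks := (Real.rpow_pos_of_pos (freqNorm_pos hk) s).ne'
    have e : ((freqNorm k ^ (-s) : ℝ) : ℂ) * ((freqNorm k ^ s : ℝ) : ℂ) = 1 := by
      rw [← Complex.ofReal_mul, Real.rpow_neg (freqNorm_nonneg k), inv_mul_cancel₀ hks,
        Complex.ofReal_one]
    rw [commSeq, ← mul_assoc, ← tsum_mul_left]
    refine tsum_congr fun j => ?_
    simp only [streamSeq, lambdaPow, freqNorm_neg, hf]
    push_cast
    linear_combination (x (-k) * (triadSymbol s (k - j) (-k) * (g j * x (k - j)))) *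
      ((σ * σ : ℂ) * e + hσ2)
  have hxn : SqBound M fun k => x (-k) := hx.comp_injective neg_injective
  have hxs : ∀ j, SqBound M fun k => x (k - j) := fun j =>
    hx.comp_injective (sub_left_injective (b := j))
  have hsum : Summable fun p : (Fin 2 → ℤ) × (Fin 2 → ℤ) => f p.2 p.1 := by
    have hmaj : Summable fun p : (Fin 2 → ℤ) × (Fin 2 → ℤ) =>
        freqNorm p.1 ^ 2 * w p.1 * (‖x (p.2 - p.1)‖ * ‖x (-p.2)‖) := by
      refine (summable_prod_of_nonneg fun p => ?_).2 ⟨fun j => ?_, ?_⟩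
      · have := hw0 p.1
        positivity
      · exact ((hxs j).summable_mul hxn).mul_left (freqNorm j ^ 2 * w j)
      · refine (hw.mul_right M).of_nonneg_of_le (fun j => tsum_nonneg fun k => ?_) fun j => ?_
        · have := hw0 j
          positivity
        · dsimp only
          rw [tsum_mul_left]
          exact mul_le_mul_of_nonneg_left ((hxs j).tsum_mul_le hxn)
            (mul_nonneg (sq_nonneg _) (hw0 j))
    refine .of_norm_bounded hmaj fun p => ?_
    simp only [hf]
    rw [norm_mul, norm_mul, norm_mul, Complex.norm_real, Real.norm_eq_abs, mul_assoc]
    have h2 : |triadSymbol s (p.2 - p.1) (-p.2)| ≤ freqNorm p.1 ^ 2 :=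
      (abs_triadSymbol_sub_neg_le hs₀ hs₁ _ _).trans
        (mul_le_of_le_one_right (sq_nonneg _) (freqNorm_rpow_neg_le_one hs₀ _))
    have h3 := hg p.1
    gcongr
  have hcomm : ∑' k, ∑' j, f k j = ∑' j, ∑' k, f k j :=
    Summable.tsum_comm (f := fun j k => f k j) hsum
  rw [tsum_congr h1, hcomm, ← tsum_mul_left, ← (Equiv.neg _).tsum_eq]
  refine tsum_congr fun j => ?_
  simp only [Equiv.neg_apply]
  rw [nonlin, mul_assoc, ← tsum_mul_right, ← (Equiv.neg _).tsum_eq]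
  congr 1
  refine tsum_congr fun l => ?_
  simp only [Equiv.neg_apply, hf, neg_neg]
  rw [show -l - -j = j - l by abel]
  ring

end

/-! ### The weak formulation -/

/-- Parseval's identity with a continuous function. -/
theorem hasSum_coeff_mul_coeff_of_continuous (f : L2) {g : Torus → ℝ} (hg : Continuous g) :
    HasSum (fun k => coeff f k * coeff g (-k)) ((∫ x, f x * g x ∂torusMeasure : ℝ) : ℂ) := by
  have hm : MemLp g 2 torusMeasure := by
    obtain ⟨C, hC⟩ := isCompact_univ.exists_bound_of_continuousOn hg.continuousOn
    exact MemLp.of_bound hg.aestronglyMeasurable C (.of_forall fun x => hC x (mem_univ _))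
  have h := hasSum_coeff_mul_coeff hm.toLp f
  rw [coeff_congr_ae hm.coeFn_toLp] at h
  have e : ∫ x, hm.toLp g x * f x ∂torusMeasure = ∫ x, f x * g x ∂torusMeasure := by
    refine integral_congr_ae ?_
    filter_upwards [hm.coeFn_toLp] with x hx
    rw [hx, mul_comm]
  rw [e] at h
  exact h.congr_fun fun k => mul_comm _ _

/-- Integration by parts in time for a single Fourier mode. -/
theorem integral_mul_deriv_add {x γ γ' N : ℝ → ℂ} {c : ℂ} {T : ℝ} (hT : 0 ≤ T)
    (hN : Continuous N) (hx : ∀ t, 0 ≤ t → x t = c + ∫ τ in 0..t, N τ)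
    (hγ : ∀ t, HasDerivAt γ (γ' t) t) (hγ' : Continuous γ') (hγT : γ T = 0) :
    ∫ t in 0..T, (x t * γ' t + N t * γ t) = -(c * γ 0) := by
  -- `x` is controlled only for `t ≥ 0`, so the two-sided derivative at `0` is taken of the integral
  -- expression instead.
  have hX : ∀ t, HasDerivAt (fun t => c + ∫ τ in 0..t, N τ) (N t) t := fun t =>
    (hN.integral_hasStrictDerivAt 0 t).hasDerivAt.const_add c
  have h := intervalIntegral.integral_deriv_mul_eq_sub (a := 0) (b := T)
    (fun t _ => hX t) (fun t _ => hγ t) (hN.intervalIntegrable _ _)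
    (hγ'.intervalIntegrable _ _)
  rw [hγT] at h
  simp only [mul_zero, intervalIntegral.integral_same, add_zero, zero_sub] at h
  rw [← h]
  refine intervalIntegral.integral_congr fun t ht => ?_
  rw [uIcc_of_le hT] at ht
  rw [hx t ht.1, add_comm]

section

variable {σ s M : ℝ} {x : ℝ → FourierSeq} {x₀ : FourierSeq} {φ : ℝ → Torus → ℝ}

/-- The weak formulation in terms of Fourier coefficients. -/
theorem weak_formulation_coeff (hσ : |σ| = 1) (hs₀ : 0 ≤ s) (hs₁ : s ≤ 1)
    (hx : ∀ t, SqBound M (x t)) (hc : ∀ k, Continuous fun t => x t k)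
    (hsol : ∀ k t, 0 ≤ t → x t k = x₀ k + ∫ τ in 0..t, nonlin σ s (x τ) k)
    (hφ : SmoothLift φ) {T : ℝ} (hT : 0 ≤ T) (hφT : ∀ y, φ T y = 0) :
    (ContinuousOn (fun t => ∑' k, nonlin σ s (x t) k * coeff (φ t) (-k)) (Icc 0 T)) ∧
      HasSum (fun k => -(x₀ k * coeff (φ 0) (-k)))
        (∫ t in 0..T, (∑' k, x t k * coeff (fun y => deriv (fun s => φ s y) t) (-k)
          + ∑' k, nonlin σ s (x t) k * coeff (φ t) (-k))) := by
  obtain ⟨w, hw0, hw, hwφ⟩ := hφ.exists_summable_bound 0 T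
  obtain ⟨v, hv0, hv, hvφ⟩ := hφ.timeDeriv.exists_summable_bound 0 T
  have hM := (hx 0).nonneg
  have hγ := hφ.hasDerivAt_coeff
  have hγc : ∀ k, Continuous fun t => coeff (φ t) k := fun k =>
    continuous_iff_continuousAt.2 fun t => (hγ k t).continuousAt
  have hγ'c : ∀ k, Continuous fun t => coeff (fun y => deriv (fun s => φ s y) t) k := fun k =>
    continuous_iff_continuousAt.2 fun t => (hφ.timeDeriv.hasDerivAt_coeff k t).continuousAt
  have hNc := continuous_nonlin (σ := σ) hs₀ hs₁ hx hc
  have hb₁ : ∀ k, ∀ t ∈ Icc 0 T, ‖nonlin σ s (x t) k * coeff (φ t) (-k)‖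
      ≤ M / 2 * ((1 + freqNorm (-k) ^ 2) * w (-k)) := by
    intro k t ht
    rw [norm_mul]
    have h1 := norm_nonlin_le (σ := σ) hs₀ hs₁ (hx t) k
    have h2 := hwφ t ht (-k)
    rw [hσ] at h1
    have h3 := hw0 (-k)
    calc _ ≤ (1 / 2 * (freqNorm k ^ 2 * M)) * w (-k) := by gcongr
      _ ≤ (1 / 2 * ((1 + freqNorm k ^ 2) * M)) * w (-k) := by gcongr; linarith
      _ = _ := by rw [freqNorm_neg]; ring
  have hs₁' : Summable fun k => M / 2 * ((1 + freqNorm (-k) ^ 2) * w (-k)) :=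
    ((Equiv.neg _).summable_iff.2 hw).mul_left _
  have hb₂ : ∀ k, ∀ t ∈ Icc 0 T, ‖x t k * coeff (fun y => deriv (fun s => φ s y) t) (-k)‖
      ≤ Real.sqrt M * ((1 + freqNorm (-k) ^ 2) * v (-k)) := by
    intro k t ht
    rw [norm_mul]
    have h1 := (hx t).norm_le k
    have h2 : ‖coeff (fun y => deriv (fun s => φ s y) t) (-k)‖ ≤ v (-k) := hvφ t ht (-k)
    have h3 := hv0 (-k)
    calc _ ≤ Real.sqrt M * v (-k) := by gcongr
      _ ≤ _ := by
        gcongr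
        nlinarith [mul_nonneg (sq_nonneg (freqNorm (-k))) h3]
  have hs₂ : Summable fun k => Real.sqrt M * ((1 + freqNorm (-k) ^ 2) * v (-k)) :=
    ((Equiv.neg _).summable_iff.2 hv).mul_left _
  refine ⟨continuousOn_tsum (fun k => ((hNc k).mul (hγc (-k))).continuousOn) hs₁'
    fun k t ht => hb₁ k t ht, ?_⟩
  have hterm : ∀ k, ∫ t in 0..T, (x t k * coeff (fun y => deriv (fun s => φ s y) t) (-k)
      + nonlin σ s (x t) k * coeff (φ t) (-k)) = -(x₀ k * coeff (φ 0) (-k)) := by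
    intro k
    refine integral_mul_deriv_add hT (hNc k) (hsol k) (hγ (-k)) (hγ'c (-k)) ?_
    simp [coeff_eq_integral, hφT]
  simp_rw [← hterm]
  refine intervalIntegral.hasSum_integral_of_dominated_convergence
    (fun k _ => Real.sqrt M * ((1 + freqNorm (-k) ^ 2) * v (-k))
      + M / 2 * ((1 + freqNorm (-k) ^ 2) * w (-k))) (fun k => ?_) (fun k => ?_) ?_ ?_ ?_
  · exact (((hc k).mul (hγ'c (-k))).add ((hNc k).mul (hγc (-k)))).aestronglyMeasurable
  · refine .of_forall fun t ht => ?_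
    rw [uIoc_of_le hT] at ht
    have ht' := Ioc_subset_Icc_self ht
    exact (norm_add_le _ _).trans (add_le_add (hb₂ k t ht') (hb₁ k t ht'))
  · exact .of_forall fun t _ => hs₂.add hs₁'
  · exact intervalIntegrable_const
  · refine .of_forall fun t ht => ?_
    rw [uIoc_of_le hT] at ht
    have ht' := Ioc_subset_Icc_self ht
    exact (Summable.of_norm_bounded hs₂ fun k => hb₂ k t ht').hasSum.add
      (Summable.of_norm_bounded hs₁' fun k => hb₁ k t ht').hasSum

end

/-- Solutions of the equation for the Fourier coefficients are weak solutions. -/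
theorem isWeakSolution_of_coeff {σ β M T : ℝ} (hσ : |σ| = 1) (hβ₁ : 1 < β) (hβ₂ : β ≤ 2)
    (hT : 0 < T) {θ₀ : L2} {θ : ℝ → L2} (hθM : ∀ t, ‖θ t‖ ≤ M)
    (hc : ∀ k, Continuous fun t => coeff (θ t) k)
    (hsol : ∀ k t, 0 ≤ t → coeff (θ t) k
      = coeff θ₀ k + ∫ τ in 0..t, nonlin σ (2 - β) (coeff (θ τ)) k) :
    IsWeakSolution σ β T θ₀ θ := by
  have hs₀ : 0 ≤ 2 - β := by linarith
  have hs₁ : 2 - β ≤ 1 := by linarith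
  have hM0 : 0 ≤ M := (norm_nonneg _).trans (hθM 0)
  have hx : ∀ t, SqBound (M ^ 2) (coeff (θ t)) := fun t S =>
    (sqBound_coeff (θ t) S).trans (pow_le_pow_left₀ (norm_nonneg _) (hθM t) 2)
  have hψ : ∀ t, ∃ ψ : L2, coeff ψ = streamSeq σ (2 - β) (coeff (θ t)) := fun t => by
    obtain ⟨ψ, hψ, -⟩ := exists_coeff_eq
      ((hx t).mono_norm fun k => norm_streamSeq_le (s := 2 - β) hσ hs₀ k)
      (isRealSeq_coeff (θ t)).streamSeq
    exact ⟨ψ, hψ⟩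
  choose ψ hψ using hψ
  refine ⟨memLp_top_of_bound
    (stronglyMeasurable_of_continuous_coeff hc).aestronglyMeasurable M (.of_forall hθM),
    ψ, .of_forall fun t => ?_, fun φ hφ => ?_⟩
  · funext k
    rw [hψ, streamSeq, neg_sub]
  have hφs : SmoothLift φ := hφ.smooth
  obtain ⟨T', hT', hsupp⟩ := hφ.support
  -- The commutator is built at each time separately, with no measurability in `t`. Integrability of
  -- its pairing with `ψ` comes from the second clause, whose right-hand side is continuous on
  -- `[0,T]`.
  have hC : ∀ t, ∃ C : L2, coeff C = perpCommutator (2 - β) (φ t) (ψ t) ∧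
      ((σ / 2 * ∫ x, ψ t x * C x ∂torusMeasure : ℝ) : ℂ)
        = ∑' k, nonlin σ (2 - β) (coeff (θ t)) k * coeff (φ t) (-k) := by
    intro t
    obtain ⟨w, hw0, hw, hwφ⟩ := hφs.exists_summable_bound t t
    have hg := hwφ t ⟨le_rfl, le_rfl⟩
    have hw' : Summable fun k => freqNorm k ^ 2 * w k :=
      hw.of_nonneg_of_le (fun k => mul_nonneg (sq_nonneg _) (hw0 k)) fun k => by
        have := hw0 k
        gcongr
        linarith
    obtain ⟨C, hC, -⟩ := exists_coeff_eq (sqBound_commSeq hσ hs₀ hs₁ (hx t) hg hw')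
      ((isRealSeq_coeff (θ t)).commSeq (isRealSeq_coeff (φ t)))
    refine ⟨C, ?_, ?_⟩
    · rw [hC, perpCommutator, hφs.coeff_torusPartial, hφs.coeff_torusPartial, hψ,
        commutator_sub_commutator_eq hσ hs₀ (hx t) hg hw]
    · rw [← tsum_streamSeq_mul_commSeq hσ hs₀ hs₁ (hx t) hg hw', ← hC, ← hψ,
        (hasSum_coeff_mul_coeff (ψ t) C).tsum_eq]
      push_cast
      ring
  choose C hC₁ hC₂ using hC
  obtain ⟨hcont, hsum⟩ := weak_formulation_coeff hσ hs₀ hs₁ hx hc hsol hφs hT.le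
    (hsupp T hT'.le)
  refine ⟨C, .of_forall hC₁, ?_, ?_⟩
  · have h1 : ContinuousOn (fun t => 2 * σ * (∑' k, nonlin σ (2 - β) (coeff (θ t)) k
        * coeff (φ t) (-k)).re) (Icc 0 T) :=
      (Complex.continuous_re.comp_continuousOn hcont).const_mul _
    refine (h1.integrableOn_compact isCompact_Icc).congr_fun (fun t _ => ?_) measurableSet_Icc
    simp only
    rw [← hC₂, Complex.ofReal_re]
    have hσ2 : σ * σ = 1 := by rw [← abs_mul_abs_self, hσ, one_mul]
    linear_combination (∫ x, ψ t x * C t x ∂torusMeasure) * hσ2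
  · apply Complex.ofReal_injective
    refine (integral_ofReal (𝕜 := ℂ)).symm.trans ?_
    rw [integral_Icc_eq_integral_Ioc, ← intervalIntegral.integral_of_le hT.le,
      Complex.ofReal_neg,
      ((hasSum_coeff_mul_coeff_of_continuous θ₀ (hφs.continuous 0)).neg).unique hsum]
    refine intervalIntegral.integral_congr fun t _ => ?_
    rw [← hC₂,
      (hasSum_coeff_mul_coeff_of_continuous (θ t) (hφs.timeDeriv.continuous t)).tsum_eq]
    push_cast
    rfl

end GSQG

/-- The coefficient system is solved on all of `[0,∞)` with an `ℓ²` bound uniform in time, so the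
one `θ` that Riesz–Fischer yields serves every `T`. -/
theorem mainTheorem3 (σ β : ℝ) (hσ : σ = 1 ∨ σ = -1) (hβ₁ : 1 < β) (hβ₂ : β ≤ 2)
    (θ₀ : GSQG.L2) (hmean : ∫ x, θ₀ x ∂GSQG.torusMeasure = 0) :
    ∃ θ : ℝ → GSQG.L2, ∀ T : ℝ, 0 < T → GSQG.IsWeakSolution σ β T θ₀ θ := by
  have hσ' : |σ| = 1 := by rcases hσ with rfl | rfl <;> simp
  obtain ⟨x, hx, hr, hc, hsol⟩ := GSQG.exists_fourier_solution (σ := σ) (s := 2 - β)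
    (by linarith) (by linarith) (GSQG.sqBound_coeff θ₀) (GSQG.isRealSeq_coeff θ₀)
  choose θ hθ hθM using fun t => GSQG.exists_coeff_eq (hx t) (hr t)
  refine ⟨θ, fun T hT => GSQG.isWeakSolution_of_coeff hσ' hβ₁ hβ₂ hT hθM ?_ ?_⟩
  · simpa only [hθ] using hc
  · simpa only [hθ] using hsol
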